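/- Let $R$ be a commutative noetherian ring; algebras are associative and unital, $(-)^*=\mathrm{Hom}_R(-,R)$, $\otimes=\otimes_R$, and for a coalgebra $C$ the module $C^*$ carries the convolution product. \emph{Definitions.} For an $R$-algebra $A$ put $A^\circ=\{f\in A^*: AfA \text{ is finitely generated over } R\}$, where $(afb)(x)=f(bxa)$; $A$ is an \emph{$\alpha$-algebra} if $A^\circ$ is a pure submodule of $R^A$, i.e. $A^\circ\otimes N\to R^A\otimes N$ is injective for all $R$-modules $N$. A \emph{right-right Doi-Koppinen structure} $(H,A,C)$ consists of an $R$-bialgebra $H$, a right $H$-comodule algebra $A$ (coaction $a\mapsto\sum a_{0}\otimes a_{1}$, an algebra map) and a right $H$-module coalgebra $C$ (action $C\otimes H\to C$, a coalgebra map); put $\psi(c\otimes a)=\sum a_0\otimes ca_1$. A \emph{morphism} $(\beta,\gamma,\delta):(H,A,C)\to(K,B,D)$ consists of a bialgebra map $\beta:H\to K$, an algebra map $\gamma:A\to B$ and a coalgebra map $\delta:C\to D$ with $\sum\gamma(a_0)\otimes\delta(ca_1)=\sum\gamma(a)_0\otimes\delta(c)\gamma(a)_1$. A \emph{Doi-Koppinen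 module} is a right $A$-module and right $C$-comodule $M$ with $\varrho(ma)=\sum m_0a_0\otimes m_1a_1$; with the $A$-linear $C$-colinear maps these form the category $\mathcal M(H)_A^C$. Let $\#^{op}(C,A)$ be $\mathrm{Hom}_R(C,A)$ with product $(f\cdot g)(c)=\sum f(c_2)_0\,g(c_1f(c_2)_1)$ and unit $c\mapsto\varepsilon(c)1$. A right $\#^{op}(C,A)$-module $N$ is a right $A$-module through $a\mapsto[c\mapsto\varepsilon(c)a]$; it is \emph{rational} if for each $n\in N$ there is $\sum n_i\otimes c_i\in N\otimes C$ with $n\cdot f=\sum n_if(c_i)$ for all $f$. Write $\mathrm{Rat}^C(\mathcal M_{\#^{op}(C,A)})$ for the full subcategory of rational modules, and $\sigma[K]$ for the full subcategory of the modules isomorphic to a submodule of a quotient of a direct sum of copies of $K$. If $H$ is an $\alpha$-algebra, let $C^0\subseteq C^*$ be the set of the $g$ for which there is $\sum g_i\otimes u_i\in C^*\otimes H^\circ$ with $g(ch)=\sum g_i(c)u_i(h)$ for all $c\in C$, $h\in H$. \emph{Theorem.} (1) Let $(H,A,C)$ be a right-right Doi-Koppinen structure with $H$ and $A$ $\alpha$-algebras.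 Then the transposes of the operations of $(H,A,C)$ make $(H^\circ,C^0,A^\circ)$ a right-right Doi-Koppinen structure: $A^\circ$ is a coalgebra with $\sum f_1(a)f_2(b)=f(ab)$, $\varepsilon(f)=f(1)$; $H^\circ$ is a bialgebra with the convolution product and $\sum u_1(h)u_2(k)=u(hk)$, $\varepsilon(u)=u(1)$; $C^0$ is a subalgebra of $C^*$ with coaction $\sum g_0(c)g_1(h)=g(ch)$; and $H^\circ$ acts on $A^\circ$ by $(fu)(a)=\sum f(a_0)u(a_1)$. It is dual to $(H,A,C)$: the canonical map $C^0\otimes A^\circ\to(C\otimes A)^*$ is injective, and the map $A^\circ\otimes C^0\to C^0\otimes A^\circ$, $f\otimes g\mapsto\sum g_0\otimes fg_1$, is the restriction of $\psi^*$. Doi-Koppinen modules are right $\#^{op}(A^\circ,C^0)$-modules through $m\cdot f=\sum m_0f(m_1)$, and this gives an isomorphism of categories $$\mathcal M(H^\circ)_{C^0}^{A^\circ}\simeq\mathrm{Rat}^{A^\circ}(\mathcal M_{\#^{op}(A^\circ,C^0)})=\sigma[(C^0\otimes A^\circ)_{\#^{op}(A^\circ,C^0)}],$$ where $C^0\otimes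 A^\circ$ is the Doi-Koppinen module with $(b\otimes f)a=\sum ba_0\otimes fa_1$ and $\varrho(b\otimes f)=\sum (b\otimes f_1)\otimes f_2$. If moreover $A$ is finitely generated projective over $R$, then $A^\circ=A^*$ and the same assignment is an isomorphism of categories $\mathcal M(H^\circ)_{C^0}^{A^*}\simeq\mathcal M_{\#^{op}(A^*,C^0)}$. (2) Let $(\beta,\gamma,\delta):(H,A,C)\to(K,B,D)$ be a morphism of right-right Doi-Koppinen structures, where $H,K,A,B$ are $\alpha$-algebras. If $\delta^*(D^0)\subseteq C^0$, then $\beta^*,\delta^*,\gamma^*$ restrict to a morphism of Doi-Koppinen structures $(\beta^\circ,\delta^0,\gamma^\circ):(K^\circ,D^0,B^\circ)\to(H^\circ,C^0,A^\circ)$. The condition $\delta^*(D^0)\subseteq C^0$ holds, for example, if $\delta(ch)=\delta(c)\beta(h)$ for all $c\in C$, $h\in H$, or if $C^0=C^*$. -/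

import Mathlib

open scoped TensorProduct
open MulOpposite CategoryTheory

universe u vH vA vC vK vB vD w

/-! ### Pure submodules, the finite dual of an algebra, `α`-algebras -/

section FiniteDual

/-- A submodule `K` of `M` is pure (in the sense of Cohn) if `K ⊗ N → M ⊗ N` is injective for
every `R`-module `N`. (As tensor products commute with directed unions and every finitely
generated `R`-module has a copy in the universe of `R`, it is enough to let `N` range over that
universe.) -/
def IsCohnPure {R : Type u} [CommRing R] {M : Type vA} [AddCommGroup M] [Module R M]
    (K : Submodule R M) : Prop :=
  ∀ (N : Type u) [AddCommGroup N] [Module R N],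
    Function.Injective (LinearMap.rTensor N K.subtype)

/-- The sub-bimodule `A f A` of `A^*` generated by `f`; here `(a f b)(x) = f (b x a)`. -/
def bimoduleSpan {R : Type u} [CommRing R] {A : Type vA} [Ring A] [Algebra R A]
    (f : Module.Dual R A) : Submodule R (Module.Dual R A) :=
  Submodule.span R (Set.range fun p : A × A =>
    f ∘ₗ LinearMap.mulLeft R p.1 ∘ₗ LinearMap.mulRight R p.2)

/-- The finite dual `A° = {f ∈ A^* | A f A is finitely generated over R}` of an algebra over a
noetherian ring. -/
def finiteDual (R : Type u) [CommRing R] [IsNoetherianRing R] (A : Type vA) [Ring A]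
    [Algebra R A] : Submodule R (Module.Dual R A) where
  carrier := {f | (bimoduleSpan f).FG}
  zero_mem' := by
    refine Submodule.FG.of_le (T := ⊥) Submodule.fg_bot ?_
    refine Submodule.span_le.mpr ?_
    rintro _ ⟨p, rfl⟩
    simp
  add_mem' := by
    intro f g hf hg
    refine Submodule.FG.of_le (T := bimoduleSpan f ⊔ bimoduleSpan g) (hf.sup hg) ?_
    refine Submodule.span_le.mpr ?_
    rintro _ ⟨p, rfl⟩
    simp only [LinearMap.add_comp]
    exact Submodule.add_mem_sup (Submodule.subset_span ⟨p, rfl⟩) (Submodule.subset_span ⟨p, rfl⟩)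
  smul_mem' := by
    intro r f hf
    refine Submodule.FG.of_le (T := bimoduleSpan f) hf ?_
    refine Submodule.span_le.mpr ?_
    rintro _ ⟨p, rfl⟩
    simp only [LinearMap.smul_comp]
    exact Submodule.smul_mem _ _ (Submodule.subset_span ⟨p, rfl⟩)

/-- `A` is an `α`-algebra if `A°` is pure in the module `R^A` of all functions `A → R`. -/
def IsAlphaAlgebra (R : Type u) [CommRing R] [IsNoetherianRing R] (A : Type vA) [Ring A]
    [Algebra R A] : Prop :=
  IsCohnPure ((finiteDual R A).map (LinearMap.ltoFun R A R R))

/-- The finite dual `H°` of a bialgebra, as a subalgebra of `H^*` with the convolution product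
`(f ⋆ g)(h) = ∑ f (h₁) g (h₂)`. -/
noncomputable def finiteDualAlg (R : Type u) [CommRing R] [IsNoetherianRing R] (H : Type vH)
    [Ring H] [Bialgebra R H] : Subalgebra R (WithConv (H →ₗ[R] R)) where
  carrier := {f | f.ofConv ∈ finiteDual R H}
  add_mem' := fun hf hg => (finiteDual R H).add_mem hf hg
  mul_mem' := by
    intro f g hf hg
    let e := WithConv.linearEquiv R (H →ₗ[R] R)
    let T : Module.Dual R H →ₗ[R] Module.Dual R H →ₗ[R] Module.Dual R H :=
      ((LinearMap.mul R (WithConv (H →ₗ[R] R))).compl₁₂ e.symm.toLinearMap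
        e.symm.toLinearMap).compr₂ e.toLinearMap
    have hT : ∀ (p q : Module.Dual R H) (x : H),
        T p q x = LinearMap.mul' R R (TensorProduct.map p q (Coalgebra.comul x)) :=
      fun p q x => rfl
    refine Submodule.FG.of_le
      (T := Submodule.map₂ T (bimoduleSpan f.ofConv) (bimoduleSpan g.ofConv))
      (Submodule.FG.map₂ _ hf hg) ?_
    refine Submodule.span_le.mpr ?_
    rintro _ ⟨⟨a, b⟩, rfl⟩
    let ra := Coalgebra.Repr.arbitrary R a
    let rb := Coalgebra.Repr.arbitrary R b
    have key : (f * g).ofConv ∘ₗ LinearMap.mulLeft R a ∘ₗ LinearMap.mulRight R b =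
        ∑ i ∈ ra.index, ∑ j ∈ rb.index,
          T (f.ofConv ∘ₗ LinearMap.mulLeft R (ra.left i) ∘ₗ LinearMap.mulRight R (rb.left j))
            (g.ofConv ∘ₗ LinearMap.mulLeft R (ra.right i) ∘ₗ
              LinearMap.mulRight R (rb.right j)) := by
      ext x
      simp only [LinearMap.sum_apply, hT, LinearMap.comp_apply, LinearMap.mulLeft_apply,
        LinearMap.mulRight_apply]
      have h1 : (f * g).ofConv (a * (x * b)) = LinearMap.mul' R R
          (TensorProduct.map f.ofConv g.ofConv (Coalgebra.comul (R := R) (a * (x * b)))) := rfl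
      rw [h1, Bialgebra.comul_mul, Bialgebra.comul_mul]
      generalize Coalgebra.comul (R := R) x = t
      induction t with
      | zero => simp
      | add s t hs ht => simp only [mul_add, add_mul, map_add, hs, ht, Finset.sum_add_distrib]
      | tmul y z =>
        rw [← ra.eq, ← rb.eq]
        simp only [Finset.sum_mul, Finset.mul_sum, Algebra.TensorProduct.tmul_mul_tmul, map_sum,
          TensorProduct.map_tmul, LinearMap.mul'_apply]
        exact Finset.sum_comm
    change (f * g).ofConv ∘ₗ LinearMap.mulLeft R a ∘ₗ LinearMap.mulRight R b ∈ _
    rw [key]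
    exact Submodule.sum_mem _ fun i _ => Submodule.sum_mem _ fun j _ =>
      Submodule.apply_mem_map₂ _ (Submodule.subset_span ⟨(_, _), rfl⟩)
        (Submodule.subset_span ⟨(_, _), rfl⟩)
  algebraMap_mem' := by
    intro r
    have h0 : (algebraMap R (WithConv (H →ₗ[R] R)) r).ofConv =
        r • (Coalgebra.counit : H →ₗ[R] R) := by
      ext x
      change (algebraMap R (WithConv (H →ₗ[R] R)) r) x = _
      simp
    refine Submodule.FG.of_le (T := Submodule.span R {(Coalgebra.counit : H →ₗ[R] R)})
      (Submodule.fg_span_singleton _) ?_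
    refine Submodule.span_le.mpr ?_
    rintro _ ⟨⟨a, b⟩, rfl⟩
    refine Submodule.mem_span_singleton.mpr
      ⟨r * (Coalgebra.counit (R := R) a * Coalgebra.counit (R := R) b), ?_⟩
    ext x
    simp only [h0, LinearMap.comp_apply, LinearMap.smul_apply, LinearMap.mulLeft_apply,
      LinearMap.mulRight_apply, Bialgebra.counit_mul, smul_eq_mul]
    ring

end FiniteDual

/-! ### Doi-Koppinen structures -/

/-- A right-right Doi-Koppinen structure `(H, A, C)`: a bialgebra `H`, a right `H`-comodule
algebra `A` with coaction `a ↦ ∑ a₀ ⊗ a₁` and a right `H`-module coalgebra `C` with action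
`c ⊗ h ↦ c h`. -/
structure DoiKoppinen (R : Type u) [CommRing R] (H : Type vH) (A : Type vA) (C : Type vC)
    [Ring H] [Bialgebra R H] [Ring A] [Algebra R A]
    [AddCommGroup C] [Module R C] [Coalgebra R C] where
  /-- the coaction `A → A ⊗ H`, an algebra morphism -/
  coact : A →ₐ[R] A ⊗[R] H
  coact_coassoc :
    TensorProduct.assoc R A H H ∘ₗ coact.toLinearMap.rTensor H ∘ₗ coact.toLinearMap =
      (Coalgebra.comul (R := R) (A := H)).lTensor A ∘ₗ coact.toLinearMap
  coact_counit :
    TensorProduct.rid R A ∘ₗ (Coalgebra.counit (R := R) (A := H)).lTensor A ∘ₗ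
      coact.toLinearMap = LinearMap.id
  /-- the action `C ⊗ H → C`, a coalgebra morphism -/
  act : C ⊗[R] H →ₗc[R] C
  act_one : ∀ c : C, act (c ⊗ₜ 1) = c
  act_mul : ∀ (c : C) (h k : H), act (c ⊗ₜ (h * k)) = act (act (c ⊗ₜ h) ⊗ₜ k)

namespace DoiKoppinen

variable {R : Type u} [CommRing R] {H : Type vH} {A : Type vA} {C : Type vC}
  [Ring H] [Bialgebra R H] [Ring A] [Algebra R A] [AddCommGroup C] [Module R C] [Coalgebra R C]
  {K : Type vK} {B : Type vB} {D : Type vD}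
  [Ring K] [Bialgebra R K] [Ring B] [Algebra R B] [AddCommGroup D] [Module R D] [Coalgebra R D]

/-- The entwining map `ψ : C ⊗ A → A ⊗ C`, `c ⊗ a ↦ ∑ a₀ ⊗ c a₁`. -/
noncomputable def psi (X : DoiKoppinen R H A C) : C ⊗[R] A →ₗ[R] A ⊗[R] C :=
  X.act.toLinearMap.lTensor A ∘ₗ (TensorProduct.leftComm R C A H).toLinearMap ∘ₗ
    X.coact.toLinearMap.lTensor C

/-- A morphism `(β, γ, δ) : (H, A, C) → (K, B, D)` of Doi-Koppinen structures:
`∑ γ (a₀) ⊗ δ (c a₁) = ∑ γ (a)₀ ⊗ δ (c) γ (a)₁`. -/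
structure Hom (X : DoiKoppinen R H A C) (Y : DoiKoppinen R K B D) where
  β : H →ₐc[R] K
  γ : A →ₐ[R] B
  δ : C →ₗc[R] D
  comm : ∀ (a : A) (c : C),
    TensorProduct.map γ.toLinearMap δ.toLinearMap (X.psi (c ⊗ₜ a)) = Y.psi (δ c ⊗ₜ γ a)

/-- Right multiplication `M ⊗ A → M` of a right `A`-module `M`. -/
noncomputable def rsmul (R : Type u) [CommRing R] (A : Type vA) [Ring A] [Algebra R A]
    (M : Type w) [AddCommGroup M] [Module R M] [Module Aᵐᵒᵖ M] [IsScalarTower R Aᵐᵒᵖ M] :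
    M ⊗[R] A →ₗ[R] M :=
  TensorProduct.lift
    (((Algebra.lsmul R R M).toLinearMap ∘ₗ (opLinearEquiv R (M := A)).toLinearMap).flip)

@[simp] lemma rsmul_tmul (M : Type w) [AddCommGroup M] [Module R M] [Module Aᵐᵒᵖ M]
    [IsScalarTower R Aᵐᵒᵖ M] (m : M) (a : A) : rsmul R A M (m ⊗ₜ a) = op a • m := by
  simp [rsmul]

/-- The right `A`-action `(m ⊗ c) a = ∑ m a₀ ⊗ c a₁` on `M ⊗ C`. -/
noncomputable def diagAct (X : DoiKoppinen R H A C) (M : Type w) [AddCommGroup M] [Module R M]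
    [Module Aᵐᵒᵖ M] [IsScalarTower R Aᵐᵒᵖ M] : (M ⊗[R] C) ⊗[R] A →ₗ[R] M ⊗[R] C :=
  (rsmul R A M).rTensor C ∘ₗ (TensorProduct.assoc R M A C).symm.toLinearMap ∘ₗ
    X.psi.lTensor M ∘ₗ (TensorProduct.assoc R M C A).toLinearMap

end DoiKoppinen

open DoiKoppinen

/-- A right-right Doi-Koppinen module: a right `A`-module and right `C`-comodule `M` with
`ρ (m a) = ∑ m₀ a₀ ⊗ m₁ a₁`. -/
structure DKMod {R : Type u} [CommRing R] {H : Type vH} {A : Type vA} {C : Type vC}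
    [Ring H] [Bialgebra R H] [Ring A] [Algebra R A]
    [AddCommGroup C] [Module R C] [Coalgebra R C] (X : DoiKoppinen R H A C) where
  carrier : Type w
  [addCommGroup : AddCommGroup carrier]
  [moduleR : Module R carrier]
  [moduleA : Module Aᵐᵒᵖ carrier]
  [tower : IsScalarTower R Aᵐᵒᵖ carrier]
  /-- the coaction -/
  coact : carrier →ₗ[R] carrier ⊗[R] C
  coact_coassoc :
    TensorProduct.assoc R carrier C C ∘ₗ coact.rTensor C ∘ₗ coact =
      (Coalgebra.comul (R := R) (A := C)).lTensor carrier ∘ₗ coact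
  coact_counit :
    TensorProduct.rid R carrier ∘ₗ (Coalgebra.counit (R := R) (A := C)).lTensor carrier ∘ₗ
      coact = LinearMap.id
  coact_smul : ∀ (m : carrier) (a : A),
    coact (op a • m) = X.diagAct carrier (coact m ⊗ₜ a)

attribute [instance] DKMod.addCommGroup DKMod.moduleR DKMod.moduleA DKMod.tower

namespace DoiKoppinen

variable {R : Type u} [CommRing R] {H : Type vH} {A : Type vA} {C : Type vC}
  [Ring H] [Bialgebra R H] [Ring A] [Algebra R A] [AddCommGroup C] [Module R C] [Coalgebra R C]

section Facts

variable (X : DoiKoppinen R H A C)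

lemma psi_one (c : C) : X.psi (c ⊗ₜ 1) = 1 ⊗ₜ c := by
  simp [psi, Algebra.TensorProduct.one_def, X.act_one]

/-- `∑ a₀ ⊗ c a₁` as a function of `c ⊗ (a₀ ⊗ a₁)`. -/
lemma psi_tmul (c : C) (a : A) :
    X.psi (c ⊗ₜ a) = X.act.toLinearMap.lTensor A
      (TensorProduct.leftComm R C A H (c ⊗ₜ X.coact a)) := rfl

lemma psi_mul (c : C) (a b : A) :
    X.psi (c ⊗ₜ (a * b)) =
      (LinearMap.mul' R A).rTensor C ((TensorProduct.assoc R A A C).symm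
        (X.psi.lTensor A (TensorProduct.assoc R A C A (X.psi (c ⊗ₜ a) ⊗ₜ b)))) := by
  rw [psi_tmul, psi_tmul, map_mul]
  generalize X.coact a = s
  induction s with
  | zero => simp
  | add s s' hs hs' =>
    simp only [add_mul, TensorProduct.tmul_add, TensorProduct.add_tmul, map_add, hs, hs']
  | tmul x h =>
    simp only [TensorProduct.leftComm_tmul, LinearMap.lTensor_tmul, TensorProduct.assoc_tmul,
      psi_tmul]
    generalize X.coact b = t
    induction t with
    | zero => simp
    | add t t' ht ht' => simp only [mul_add, TensorProduct.tmul_add, map_add, ht, ht']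
    | tmul y k =>
      simp only [Algebra.TensorProduct.tmul_mul_tmul, TensorProduct.leftComm_tmul,
        LinearMap.lTensor_tmul, TensorProduct.assoc_symm_tmul, LinearMap.rTensor_tmul,
        LinearMap.mul'_apply]
      erw [X.act_mul]
      rfl

lemma psi_counit (c : C) (a : A) :
    TensorProduct.rid R A ((Coalgebra.counit (R := R) (A := C)).lTensor A (X.psi (c ⊗ₜ a))) =
      Coalgebra.counit (R := R) c • a := by
  have h := LinearMap.congr_fun X.coact_counit a
  simp only [LinearMap.comp_apply, AlgHom.toLinearMap_apply, LinearMap.id_apply,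
    LinearEquiv.coe_coe] at h
  rw [psi_tmul]
  conv_rhs => rw [← h]
  generalize X.coact a = s
  induction s with
  | zero => simp
  | add s s' hs hs' => simp only [TensorProduct.tmul_add, map_add, hs, hs', smul_add]
  | tmul x k =>
    have h2 : Coalgebra.counit (R := R) (X.act (c ⊗ₜ[R] k)) =
        Coalgebra.counit (R := R) (c ⊗ₜ[R] k) := CoalgHomClass.counit_comp_apply X.act _
    simp [h2, smul_smul, mul_comm]

lemma psi_comul (c : C) (a : A) :
    (Coalgebra.comul (R := R) (A := C)).lTensor A (X.psi (c ⊗ₜ a)) =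
      TensorProduct.assoc R A C C (X.psi.rTensor C ((TensorProduct.assoc R C A C).symm
        (X.psi.lTensor C (TensorProduct.assoc R C C A
          (Coalgebra.comul (R := R) c ⊗ₜ a))))) := by
  have h := LinearMap.congr_fun X.coact_coassoc a
  simp only [LinearMap.comp_apply, AlgHom.toLinearMap_apply, LinearEquiv.coe_coe] at h
  have h1 : ∀ k : H, Coalgebra.comul (R := R) (X.act (c ⊗ₜ[R] k)) =
      TensorProduct.map X.act.toLinearMap X.act.toLinearMap
        (TensorProduct.tensorTensorTensorComm R C C H H
          (Coalgebra.comul (R := R) c ⊗ₜ Coalgebra.comul (R := R) k)) := fun k =>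
    (CoalgHomClass.map_comp_comul_apply X.act (c ⊗ₜ[R] k)).symm
  generalize Coalgebra.comul (R := R) c = d at h1 ⊢
  let Θ : A ⊗[R] (H ⊗[R] H) →ₗ[R] A ⊗[R] (C ⊗[R] C) :=
    LinearMap.lTensor A (TensorProduct.map X.act.toLinearMap X.act.toLinearMap ∘ₗ
      (TensorProduct.tensorTensorTensorComm R C C H H).toLinearMap ∘ₗ
      TensorProduct.mk R (C ⊗[R] C) (H ⊗[R] H) d)
  have hl : (Coalgebra.comul (R := R) (A := C)).lTensor A (X.psi (c ⊗ₜ a)) =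
      Θ ((Coalgebra.comul (R := R) (A := H)).lTensor A (X.coact a)) := by
    rw [psi_tmul]
    generalize X.coact a = s
    induction s with
    | zero => simp
    | add s s' hs hs' => simp only [TensorProduct.tmul_add, map_add, hs, hs']
    | tmul x k => simp [Θ, h1]
  rw [hl, ← h]
  clear hl h h1
  simp only [Θ]
  clear Θ
  induction d with
  | zero => simp
  | add d d' hd hd' =>
    simp only [TensorProduct.add_tmul, map_add, LinearMap.comp_add, LinearMap.lTensor_add,
      LinearMap.add_apply, hd, hd']
  | tmul d e =>
    simp only [TensorProduct.assoc_tmul, LinearMap.lTensor_tmul, psi_tmul]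
    generalize X.coact a = s
    induction s with
    | zero => simp
    | add s s' hs hs' => simp only [TensorProduct.tmul_add, map_add, hs, hs']
    | tmul x k =>
      simp only [LinearMap.rTensor_tmul, TensorProduct.leftComm_tmul, LinearMap.lTensor_tmul,
        TensorProduct.assoc_symm_tmul, AlgHom.toLinearMap_apply, psi_tmul]
      generalize X.coact x = t
      induction t with
      | zero => simp
      | add t t' ht ht' =>
        simp only [TensorProduct.tmul_add, TensorProduct.add_tmul, map_add, ht, ht']
      | tmul y l => simp

end Facts

/-- The algebra `#ᵒᵖ(C, A)`: the `R`-module `Hom_R(C, A)` with the multiplication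
`(f · g)(c) = ∑ f(c₂)₀ g(c₁ f(c₂)₁)` and the unit `c ↦ ε(c) 1`. -/
def SmashOp (_X : DoiKoppinen R H A C) : Type (max vA vC) := C →ₗ[R] A

section Smash

variable (X : DoiKoppinen R H A C)

noncomputable instance : AddCommGroup X.SmashOp := inferInstanceAs (AddCommGroup (C →ₗ[R] A))

/-- The underlying linear map of an element of `#ᵒᵖ(C, A)`. -/
def SmashOp.toLin {X : DoiKoppinen R H A C} (f : X.SmashOp) : C →ₗ[R] A := f

/-- The element of `#ᵒᵖ(C, A)` given by a linear map. -/
def SmashOp.ofLin (f : C →ₗ[R] A) : X.SmashOp := f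

@[simp] lemma SmashOp.toLin_add (f g : X.SmashOp) : (f + g).toLin = f.toLin + g.toLin := rfl

@[simp] lemma SmashOp.toLin_zero : (0 : X.SmashOp).toLin = 0 := rfl

noncomputable instance : One X.SmashOp :=
  ⟨SmashOp.ofLin X (Algebra.linearMap R A ∘ₗ Coalgebra.counit)⟩

noncomputable instance : Mul X.SmashOp :=
  ⟨fun f g => SmashOp.ofLin X (LinearMap.mul' R A ∘ₗ g.toLin.lTensor A ∘ₗ X.psi ∘ₗ
    f.toLin.lTensor C ∘ₗ Coalgebra.comul)⟩

/-- The map `A → #ᵒᵖ(C, A)`, `a ↦ (c ↦ ε(c) a)`, through which right `#ᵒᵖ(C, A)`-modules are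
right `A`-modules. -/
noncomputable def incl (a : A) : X.SmashOp :=
  SmashOp.ofLin X (LinearMap.toSpanSingleton R A a ∘ₗ Coalgebra.counit)

lemma SmashOp.toLin_one_apply (c : C) :
    (1 : X.SmashOp).toLin c = algebraMap R A (Coalgebra.counit (R := R) c) := rfl

lemma SmashOp.toLin_mul_apply (f g : X.SmashOp) (c : C) :
    (f * g).toLin c = LinearMap.mul' R A (g.toLin.lTensor A (X.psi
      (f.toLin.lTensor C (Coalgebra.comul c)))) := rfl

end Smash

section Action

variable {X : DoiKoppinen R H A C} (M : DKMod.{u, vH, vA, vC, w} X)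

/-- `m · f = ∑ m₀ f(m₁)` for `m` in a Doi-Koppinen module and `f ∈ #ᵒᵖ(C, A)`. -/
noncomputable def smashAct (f : X.SmashOp) : M.carrier →ₗ[R] M.carrier :=
  rsmul R A M.carrier ∘ₗ f.toLin.lTensor M.carrier ∘ₗ M.coact

lemma smashAct_one (m : M.carrier) : smashAct M 1 m = m := by
  have h := LinearMap.congr_fun M.coact_counit m
  simp only [LinearMap.comp_apply, LinearMap.id_apply, LinearEquiv.coe_coe] at h
  conv_rhs => rw [← h]
  simp only [smashAct, LinearMap.comp_apply]
  generalize M.coact m = t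
  induction t with
  | zero => simp
  | add t t' ht ht' => simp only [map_add, ht, ht']
  | tmul n c =>
    simp only [LinearMap.lTensor_tmul, rsmul_tmul, SmashOp.toLin_one_apply,
      TensorProduct.rid_tmul]
    rw [← MulOpposite.algebraMap_apply, algebraMap_smul]

lemma smashAct_mul (f g : X.SmashOp) (m : M.carrier) :
    smashAct M (f * g) m = smashAct M g (smashAct M f m) := by
  have hco := LinearMap.congr_fun M.coact_coassoc m
  simp only [LinearMap.comp_apply, LinearEquiv.coe_coe] at hco
  rw [← LinearEquiv.eq_symm_apply] at hco
  have h1 : ∀ t : M.carrier ⊗[R] C,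
      M.coact (rsmul R A M.carrier (f.toLin.lTensor M.carrier t)) =
        X.diagAct M.carrier (f.toLin.lTensor (M.carrier ⊗[R] C) (M.coact.rTensor C t)) := by
    intro t
    induction t with
    | zero => simp
    | add t t' ht ht' => simp only [map_add, ht, ht']
    | tmul n c => simp [M.coact_smul]
  simp only [smashAct, LinearMap.comp_apply]
  rw [h1, hco]
  generalize M.coact m = t
  induction t with
  | zero => simp
  | add t t' ht ht' => simp only [map_add, ht, ht']
  | tmul n c =>
    simp only [LinearMap.lTensor_tmul, SmashOp.toLin_mul_apply]
    generalize Coalgebra.comul (R := R) c = d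
    induction d with
    | zero => simp
    | add d d' hd hd' => simp only [TensorProduct.tmul_add, map_add, hd, hd']
    | tmul d e =>
      simp only [TensorProduct.assoc_symm_tmul, LinearMap.lTensor_tmul, diagAct,
        LinearMap.comp_apply, LinearEquiv.coe_coe, TensorProduct.assoc_tmul]
      generalize X.psi (d ⊗ₜ f.toLin e) = s
      induction s with
      | zero => simp
      | add s s' hs hs' => simp only [TensorProduct.tmul_add, map_add, hs, hs']
      | tmul a k => simp [mul_smul]

end Action

section Free

variable (X : DoiKoppinen R H A C)

/-- The right `A`-action `(b ⊗ c) a = ∑ b a₀ ⊗ c a₁` on `A ⊗ C`. -/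
noncomputable def freeAct : (A ⊗[R] C) ⊗[R] A →ₗ[R] A ⊗[R] C :=
  (LinearMap.mul' R A).rTensor C ∘ₗ (TensorProduct.assoc R A A C).symm.toLinearMap ∘ₗ
    X.psi.lTensor A ∘ₗ (TensorProduct.assoc R A C A).toLinearMap

lemma freeAct_tmul (b : A) (c : C) (a : A) :
    X.freeAct ((b ⊗ₜ c) ⊗ₜ a) = (LinearMap.mulLeft R b).rTensor C (X.psi (c ⊗ₜ a)) := by
  simp only [freeAct, LinearMap.comp_apply, LinearEquiv.coe_coe, TensorProduct.assoc_tmul,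
    LinearMap.lTensor_tmul]
  generalize X.psi (c ⊗ₜ a) = s
  induction s with
  | zero => simp
  | add s s' hs hs' => simp only [TensorProduct.tmul_add, map_add, hs, hs']
  | tmul x k => simp

lemma freeAct_one (t : A ⊗[R] C) : X.freeAct (t ⊗ₜ 1) = t := by
  induction t with
  | zero => simp
  | add s s' hs hs' => simp only [TensorProduct.add_tmul, map_add, hs, hs']
  | tmul x k => simp [freeAct_tmul, psi_one]

lemma freeAct_mul (t : A ⊗[R] C) (a b : A) :
    X.freeAct (t ⊗ₜ (a * b)) = X.freeAct (X.freeAct (t ⊗ₜ a) ⊗ₜ b) := by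
  induction t with
  | zero => simp
  | add s s' hs hs' => simp only [TensorProduct.add_tmul, map_add, hs, hs']
  | tmul x c =>
    rw [freeAct_tmul, freeAct_tmul, psi_mul]
    generalize X.psi (c ⊗ₜ a) = s
    induction s with
    | zero => simp
    | add s s' hs hs' => simp only [TensorProduct.add_tmul, map_add, hs, hs']
    | tmul y d =>
      simp only [TensorProduct.assoc_tmul, LinearMap.lTensor_tmul, LinearMap.rTensor_tmul,
        freeAct_tmul]
      generalize X.psi (d ⊗ₜ b) = s
      induction s with
      | zero => simp
      | add s s' hs hs' => simp only [TensorProduct.tmul_add, map_add, hs, hs']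
      | tmul z e => simp

/-- The right `A`-module structure `(b ⊗ c) a = ∑ b a₀ ⊗ c a₁` on `A ⊗ C`; it is not the one
coming from the right multiplication on the first tensor factor. -/
@[reducible] noncomputable def freeModule : Module Aᵐᵒᵖ (A ⊗[R] C) where
  smul a t := X.freeAct (t ⊗ₜ unop a)
  one_smul t := X.freeAct_one t
  mul_smul a b t := X.freeAct_mul t (unop b) (unop a)
  smul_zero _ := (congrArg X.freeAct (TensorProduct.zero_tmul _ _)).trans (map_zero _)
  smul_add _ _ _ := (congrArg X.freeAct (TensorProduct.add_tmul _ _ _)).trans (map_add _ _ _)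
  add_smul _ _ _ := (congrArg X.freeAct (TensorProduct.tmul_add _ _ _)).trans (map_add _ _ _)
  zero_smul _ := (congrArg X.freeAct (TensorProduct.tmul_zero _ _)).trans (map_zero _)

lemma freeTower : @IsScalarTower R Aᵐᵒᵖ (A ⊗[R] C) _ X.freeModule.toSMul _ :=
  @IsScalarTower.mk R Aᵐᵒᵖ (A ⊗[R] C) _ X.freeModule.toSMul _ fun r a t =>
    (congrArg X.freeAct (TensorProduct.tmul_smul r t (unop a))).trans
      (map_smul X.freeAct r _)

/-- The coaction `b ⊗ c ↦ ∑ (b ⊗ c₁) ⊗ c₂` on `A ⊗ C`. -/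
noncomputable def freeCoact (_X : DoiKoppinen R H A C) : A ⊗[R] C →ₗ[R] (A ⊗[R] C) ⊗[R] C :=
  (TensorProduct.assoc R A C C).symm.toLinearMap ∘ₗ
    (Coalgebra.comul (R := R) (A := C)).lTensor A

lemma freeCoact_tmul (b : A) (c : C) :
    X.freeCoact (b ⊗ₜ[R] c) =
      (TensorProduct.assoc R A C C).symm (b ⊗ₜ Coalgebra.comul (R := R) c) := rfl

lemma freeCoact_coassoc (t : A ⊗[R] C) :
    TensorProduct.assoc R (A ⊗[R] C) C C (X.freeCoact.rTensor C (X.freeCoact t)) =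
      (Coalgebra.comul (R := R) (A := C)).lTensor (A ⊗[R] C) (X.freeCoact t) := by
  induction t with
  | zero => simp
  | add s t hs ht => simp only [map_add, hs, ht]
  | tmul b c =>
    let Θ : C ⊗[R] (C ⊗[R] C) →ₗ[R] (A ⊗[R] C) ⊗[R] (C ⊗[R] C) :=
      LinearMap.rTensor (C ⊗[R] C) (TensorProduct.mk R A C b)
    have hc := congrArg Θ (Coalgebra.coassoc_apply (R := R) c)
    have h1 : ∀ d : C ⊗[R] C, TensorProduct.assoc R (A ⊗[R] C) C C (X.freeCoact.rTensor C
        ((TensorProduct.assoc R A C C).symm (b ⊗ₜ d))) = Θ (TensorProduct.assoc R C C C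
          ((Coalgebra.comul (R := R)).rTensor C d)) := by
      intro d
      induction d with
      | zero => simp
      | add d d' hd hd' => simp only [TensorProduct.tmul_add, map_add, hd, hd']
      | tmul d e =>
        simp only [TensorProduct.assoc_symm_tmul, LinearMap.rTensor_tmul, freeCoact_tmul]
        generalize Coalgebra.comul (R := R) d = t
        induction t with
        | zero => simp
        | add t t' ht ht' =>
          simp only [TensorProduct.tmul_add, TensorProduct.add_tmul, map_add, ht, ht']
        | tmul x y => rfl
    have h2 : ∀ d : C ⊗[R] C, (Coalgebra.comul (R := R) (A := C)).lTensor (A ⊗[R] C)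
        ((TensorProduct.assoc R A C C).symm (b ⊗ₜ d)) =
          Θ ((Coalgebra.comul (R := R)).lTensor C d) := by
      intro d
      induction d with
      | zero => simp
      | add d d' hd hd' => simp only [TensorProduct.tmul_add, map_add, hd, hd']
      | tmul d e => rfl
    exact (h1 _).trans (hc.trans (h2 _).symm)

lemma freeCoact_counit (t : A ⊗[R] C) :
    TensorProduct.rid R (A ⊗[R] C) ((Coalgebra.counit (R := R) (A := C)).lTensor (A ⊗[R] C)
      (X.freeCoact t)) = t := by
  induction t with
  | zero => simp
  | add s t hs ht => simp only [map_add, hs, ht]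
  | tmul b c =>
    have h1 : ∀ d : C ⊗[R] C, TensorProduct.rid R (A ⊗[R] C)
        ((Coalgebra.counit (R := R) (A := C)).lTensor (A ⊗[R] C)
          ((TensorProduct.assoc R A C C).symm (b ⊗ₜ d))) =
          (TensorProduct.mk R A C b) (TensorProduct.rid R C
            ((Coalgebra.counit (R := R)).lTensor C d)) := by
      intro d
      induction d with
      | zero => simp
      | add d d' hd hd' => simp only [TensorProduct.tmul_add, map_add, hd, hd']
      | tmul d e => simp
    rw [freeCoact_tmul, h1, Coalgebra.lTensor_counit_comul]
    simp

lemma freeCoact_smul (t : A ⊗[R] C) (a : A) :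
    X.freeCoact (X.freeAct (t ⊗ₜ a)) =
      X.freeAct.rTensor C ((TensorProduct.assoc R (A ⊗[R] C) A C).symm
        (X.psi.lTensor (A ⊗[R] C)
          (TensorProduct.assoc R (A ⊗[R] C) C A (X.freeCoact t ⊗ₜ a)))) := by
  induction t with
  | zero => simp
  | add s t hs ht => simp only [TensorProduct.add_tmul, map_add, hs, ht]
  | tmul b c =>
    have h0 : ∀ s : A ⊗[R] C, X.freeCoact ((LinearMap.mulLeft R b).rTensor C s) =
        (TensorProduct.assoc R A C C).symm ((LinearMap.mulLeft R b).rTensor (C ⊗[R] C)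
          ((Coalgebra.comul (R := R) (A := C)).lTensor A s)) := by
      intro s
      induction s with
      | zero => simp
      | add s t hs ht => simp only [map_add, hs, ht]
      | tmul x y => simp [freeCoact_tmul]
    rw [freeAct_tmul, h0, psi_comul, freeCoact_tmul]
    generalize Coalgebra.comul (R := R) c = d
    induction d with
    | zero => simp
    | add s t hs ht =>
      simp only [TensorProduct.tmul_add, TensorProduct.add_tmul, map_add, hs, ht]
    | tmul d e =>
      simp only [TensorProduct.assoc_symm_tmul, TensorProduct.assoc_tmul, LinearMap.lTensor_tmul]
      generalize X.psi (e ⊗ₜ a) = s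
      induction s with
      | zero => simp
      | add s t hs ht =>
        simp only [TensorProduct.tmul_add, TensorProduct.add_tmul, map_add, hs, ht]
      | tmul y k =>
        simp only [TensorProduct.assoc_symm_tmul, LinearMap.rTensor_tmul, freeAct_tmul]
        generalize X.psi (d ⊗ₜ y) = s
        induction s with
        | zero => simp
        | add s t hs ht =>
          simp only [TensorProduct.tmul_add, TensorProduct.add_tmul, map_add, hs, ht]
        | tmul z l => simp

lemma rsmul_free :
    @rsmul R _ A _ _ (A ⊗[R] C) _ _ X.freeModule X.freeTower = X.freeAct :=
  TensorProduct.ext' fun t a =>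
    @rsmul_tmul R _ A _ _ (A ⊗[R] C) _ _ X.freeModule X.freeTower t a

/-- The Doi-Koppinen module `A ⊗ C`, with `(b ⊗ c) a = ∑ b a₀ ⊗ c a₁` and
`ρ (b ⊗ c) = ∑ (b ⊗ c₁) ⊗ c₂`. -/
noncomputable def free : DKMod.{u, vH, vA, vC, max vA vC} X :=
  letI := X.freeModule
  haveI := X.freeTower
  { carrier := A ⊗[R] C
    addCommGroup := inferInstance
    moduleR := inferInstance
    moduleA := X.freeModule
    tower := X.freeTower
    coact := X.freeCoact
    coact_coassoc := LinearMap.ext X.freeCoact_coassoc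
    coact_counit := LinearMap.ext X.freeCoact_counit
    coact_smul := fun t a => by
      unfold diagAct
      rw [rsmul_free]
      exact X.freeCoact_smul t a }

end Free

section Ring

variable (X : DoiKoppinen R H A C)

/-- The action of `f ∈ #ᵒᵖ(C, A)` on `A ⊗ C`. -/
noncomputable def freeSmash (f : X.SmashOp) : A ⊗[R] C →ₗ[R] A ⊗[R] C :=
  X.freeAct ∘ₗ f.toLin.lTensor (A ⊗[R] C) ∘ₗ X.freeCoact

lemma smashAct_free (f : X.SmashOp) (t : A ⊗[R] C) : smashAct X.free f t = X.freeSmash f t :=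
  LinearMap.congr_fun X.rsmul_free _

lemma freeSmash_one (t : A ⊗[R] C) : X.freeSmash 1 t = t :=
  (X.smashAct_free 1 t).symm.trans (smashAct_one X.free t)

lemma freeSmash_mul (f g : X.SmashOp) (t : A ⊗[R] C) :
    X.freeSmash (f * g) t = X.freeSmash g (X.freeSmash f t) :=
  (X.smashAct_free _ t).symm.trans ((smashAct_mul X.free f g t).trans
    ((X.smashAct_free g _).trans (congrArg (X.freeSmash g) (X.smashAct_free f t))))

/-- The left `A`-linear map `A ⊗ C → A`, `b ⊗ c ↦ b f(c)`. -/
noncomputable def nu (f : X.SmashOp) : A ⊗[R] C →ₗ[R] A :=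
  LinearMap.mul' R A ∘ₗ f.toLin.lTensor A

lemma nu_one_tmul (f : X.SmashOp) (c : C) : X.nu f (1 ⊗ₜ c) = f.toLin c := by
  simp [nu]

lemma nu_mul (f g : X.SmashOp) (t : A ⊗[R] C) :
    X.nu (f * g) t = X.nu g (X.freeSmash f t) := by
  induction t with
  | zero => simp
  | add s t hs ht => simp only [map_add, hs, ht]
  | tmul b c =>
    simp only [nu, freeSmash, LinearMap.comp_apply, LinearMap.lTensor_tmul,
      LinearMap.mul'_apply, SmashOp.toLin_mul_apply, freeCoact_tmul]
    generalize Coalgebra.comul (R := R) c = d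
    induction d with
    | zero => simp
    | add s t hs ht => simp only [TensorProduct.tmul_add, map_add, mul_add, hs, ht]
    | tmul d e =>
      simp only [TensorProduct.assoc_symm_tmul, LinearMap.lTensor_tmul, freeAct_tmul]
      generalize X.psi (d ⊗ₜ f.toLin e) = s
      induction s with
      | zero => simp
      | add s t hs ht => simp only [map_add, mul_add, hs, ht]
      | tmul a k => simp [mul_assoc]

lemma SmashOp.ext' {f g : X.SmashOp} (h : ∀ c, f.toLin c = g.toLin c) : f = g :=
  LinearMap.ext h

noncomputable instance : Ring X.SmashOp :=
  { (inferInstance : AddCommGroup X.SmashOp), (inferInstance : One X.SmashOp),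
    (inferInstance : Mul X.SmashOp) with
    mul_assoc := fun f g h => SmashOp.ext' X fun c => by
      rw [← nu_one_tmul, ← nu_one_tmul, nu_mul, nu_mul, nu_mul, freeSmash_mul]
    one_mul := fun f => SmashOp.ext' X fun c => by
      rw [← nu_one_tmul, nu_mul, freeSmash_one, nu_one_tmul]
    mul_one := fun f => SmashOp.ext' X fun c => by
      have h1 : ∀ s : A ⊗[R] C, LinearMap.mul' R A ((1 : X.SmashOp).toLin.lTensor A s) =
          TensorProduct.rid R A ((Coalgebra.counit (R := R) (A := C)).lTensor A s) := by
        intro s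
        induction s with
        | zero => simp
        | add s t hs ht => simp only [map_add, hs, ht]
        | tmul a k => simp [SmashOp.toLin_one_apply, Algebra.smul_def, Algebra.commutes]
      have h2 : ∀ d : C ⊗[R] C, LinearMap.mul' R A ((1 : X.SmashOp).toLin.lTensor A
          (X.psi (f.toLin.lTensor C d))) = f.toLin (TensorProduct.lid R C
            ((Coalgebra.counit (R := R) (A := C)).rTensor C d)) := by
        intro d
        induction d with
        | zero => simp
        | add s t hs ht => simp only [map_add, hs, ht]
        | tmul d e => rw [LinearMap.lTensor_tmul, h1, psi_counit]; simp
      rw [SmashOp.toLin_mul_apply, h2, Coalgebra.rTensor_counit_comul]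
      simp
    left_distrib := fun f g h => SmashOp.ext' X fun c => by
      simp [SmashOp.toLin_mul_apply, LinearMap.lTensor_add]
    right_distrib := fun f g h => SmashOp.ext' X fun c => by
      simp [SmashOp.toLin_mul_apply, LinearMap.lTensor_add]
    zero_mul := fun f => SmashOp.ext' X fun c => by simp [SmashOp.toLin_mul_apply]
    mul_zero := fun f => SmashOp.ext' X fun c => by simp [SmashOp.toLin_mul_apply] }

end Ring

/-- A Doi-Koppinen module is a right `#ᵒᵖ(C, A)`-module through `m · f = ∑ m₀ f(m₁)`. -/
noncomputable instance {X : DoiKoppinen R H A C} (M : DKMod.{u, vH, vA, vC, w} X) :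
    Module X.SmashOpᵐᵒᵖ M.carrier where
  smul f m := smashAct M (unop f) m
  one_smul m := smashAct_one M m
  mul_smul f g m := smashAct_mul M (unop g) (unop f) m
  smul_zero f := map_zero (smashAct M (unop f))
  smul_add f m n := map_add (smashAct M (unop f)) m n
  add_smul f g m := by
    change smashAct M (unop f + unop g) m = smashAct M (unop f) m + smashAct M (unop g) m
    simp [smashAct, LinearMap.lTensor_add]
  zero_smul m := by
    change smashAct M 0 m = 0
    simp [smashAct]

end DoiKoppinen

/-! ### The category of Doi-Koppinen modules -/

namespace DKMod

variable {R : Type u} [CommRing R] {H : Type vH} {A : Type vA} {C : Type vC}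
  [Ring H] [Bialgebra R H] [Ring A] [Algebra R A] [AddCommGroup C] [Module R C] [Coalgebra R C]
  {X : DoiKoppinen R H A C}

/-- Morphisms of Doi-Koppinen modules are the `A`-linear `C`-colinear maps. -/
@[ext]
structure Hom (M N : DKMod.{u, vH, vA, vC, w} X) where
  toLin : M.carrier →ₗ[Aᵐᵒᵖ] N.carrier
  colinear : N.coact ∘ₗ toLin.restrictScalars R =
    (toLin.restrictScalars R).rTensor C ∘ₗ M.coact

instance : Category (DKMod.{u, vH, vA, vC, w} X) where
  Hom := Hom
  id M := ⟨LinearMap.id, by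
    have h : (LinearMap.id : M.carrier →ₗ[Aᵐᵒᵖ] M.carrier).restrictScalars R =
      LinearMap.id := rfl
    rw [h, LinearMap.rTensor_id]
    rfl⟩
  comp {M N P} f g := ⟨g.toLin ∘ₗ f.toLin, by
    have h : (g.toLin ∘ₗ f.toLin).restrictScalars R =
      g.toLin.restrictScalars R ∘ₗ f.toLin.restrictScalars R := rfl
    rw [h, LinearMap.rTensor_comp, LinearMap.comp_assoc, ← f.colinear, ← LinearMap.comp_assoc,
      ← LinearMap.comp_assoc, g.colinear]⟩

lemma smash_smul (M : DKMod.{u, vH, vA, vC, w} X) (f : X.SmashOp) (m : M.carrier) :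
    op f • m = rsmul R A M.carrier (f.toLin.lTensor M.carrier (M.coact m)) := rfl

/-- An `A`-linear `C`-colinear map is `#ᵒᵖ(C, A)`-linear. -/
noncomputable def Hom.toSmash {M N : DKMod.{u, vH, vA, vC, w} X} (φ : Hom M N) :
    M.carrier →ₗ[X.SmashOpᵐᵒᵖ] N.carrier where
  toFun := φ.toLin
  map_add' := φ.toLin.map_add
  map_smul' f m := by
    have h := LinearMap.congr_fun φ.colinear m
    simp only [LinearMap.comp_apply, LinearMap.restrictScalars_apply] at h
    change φ.toLin (op (unop f) • m) = op (unop f) • φ.toLin m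
    rw [smash_smul, smash_smul, h]
    generalize M.coact m = t
    induction t with
    | zero => simp
    | add s t hs ht => simp only [map_add, hs, ht]
    | tmul n c => simp

/-- The functor from Doi-Koppinen modules to right `#ᵒᵖ(C, A)`-modules that keeps the underlying
groups and maps and uses the action `m · f = ∑ m₀ f(m₁)`. -/
noncomputable def toSmash (X : DoiKoppinen R H A C) :
    DKMod.{u, vH, vA, vC, w} X ⥤ ModuleCat.{w} X.SmashOpᵐᵒᵖ where
  obj M := ModuleCat.of _ M.carrier
  map φ := ModuleCat.ofHom (Hom.toSmash φ)

end DKMod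

/-! ### Rational modules, `σ[K]`, isomorphisms of categories -/

/-- A right `#ᵒᵖ(C, A)`-module `N` is `#`-rational if for every `n` there is a (finite) tensor
`∑ mᵢ ⊗ cᵢ ∈ N ⊗ C` with `n · f = ∑ mᵢ f(cᵢ)` for all `f ∈ #ᵒᵖ(C, A)`. -/
def IsRational {R : Type u} [CommRing R] {H : Type vH} {A : Type vA} {C : Type vC}
    [Ring H] [Bialgebra R H] [Ring A] [Algebra R A] [AddCommGroup C] [Module R C] [Coalgebra R C]
    (X : DoiKoppinen R H A C) : ObjectProperty (ModuleCat.{w} X.SmashOpᵐᵒᵖ) := fun N =>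
  ∀ n : N, ∃ (k : ℕ) (m : Fin k → N) (c : Fin k → C), ∀ f : X.SmashOp,
    op f • n = ∑ i, op (X.incl (f.toLin (c i))) • m i

/-- The class `σ[K]` of `K`-subgenerated modules: modules isomorphic to a submodule of a
`K`-generated module `L`, that is, of an epimorphic image `L` of a direct sum of copies
of `K`. -/
def IsSubgenerated (S : Type vA) [Ring S] (K : Type vK) [AddCommGroup K] [Module S K] :
    ObjectProperty (ModuleCat.{w} S) := fun N =>
  ∃ (L : ModuleCat.{max w vK} S) (Λ : Type (max w vK)) (p : (Λ →₀ K) →ₗ[S] L) (j : N →ₗ[S] L),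
    Function.Surjective p ∧ Function.Injective j

/-- `F` is an isomorphism of categories. -/
def IsIsoOfCategories {𝒞 : Type*} {𝒟 : Type*} [Category 𝒞] [Category 𝒟] (F : 𝒞 ⥤ 𝒟) : Prop :=
  ∃ G : 𝒟 ⥤ 𝒞, F ⋙ G = 𝟭 𝒞 ∧ G ⋙ F = 𝟭 𝒟

/-! ### The dual Doi-Koppinen structure `(H°, C⁰, A°)` -/

/-- The elements of a subalgebra of the convolution algebra `C^*`, as linear forms on `C`. -/
noncomputable def formOf {R : Type u} [CommRing R] {C : Type vC} [AddCommGroup C] [Module R C]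
    [Coalgebra R C] (S : Subalgebra R (WithConv (C →ₗ[R] R))) : S →ₗ[R] Module.Dual R C :=
  (WithConv.linearEquiv R (C →ₗ[R] R)).toLinearMap ∘ₗ S.val.toLinearMap

/-- For linear maps `i : U → V^*` and `j : U' → W^*`, the map `U ⊗ U' → (V ⊗ W)^*` that sends
`f ⊗ g` to `v ⊗ w ↦ i(f)(v) j(g)(w)`. -/
noncomputable def tensorForm {R : Type u} [CommRing R] {U : Type*} {U' : Type*} {V : Type*}
    {W : Type*} [AddCommMonoid U] [Module R U] [AddCommMonoid U'] [Module R U'] [AddCommMonoid V]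
    [Module R V] [AddCommMonoid W] [Module R W] (i : U →ₗ[R] Module.Dual R V)
    (j : U' →ₗ[R] Module.Dual R W) : U ⊗[R] U' →ₗ[R] Module.Dual R (V ⊗[R] W) :=
  TensorProduct.dualDistrib R V W ∘ₗ TensorProduct.map i j

section Dual

variable {R : Type u} [CommRing R] [IsNoetherianRing R] {H : Type vH} {A : Type vA} {C : Type vC}
  [Ring H] [Bialgebra R H] [Ring A] [Algebra R A] [AddCommGroup C] [Module R C] [Coalgebra R C]

/-- The product of two elements of `C^* ⊗ H°`, seen in `(C ⊗ H)^*`. -/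
lemma exists_tensorForm_mul (s t : Module.Dual R C ⊗[R] finiteDualAlg R H) :
    ∃ r : Module.Dual R C ⊗[R] finiteDualAlg R H,
      WithConv.toConv (tensorForm LinearMap.id (formOf (finiteDualAlg R H)) s) *
        WithConv.toConv (tensorForm LinearMap.id (formOf (finiteDualAlg R H)) t) =
      WithConv.toConv (tensorForm LinearMap.id (formOf (finiteDualAlg R H)) r) := by
  induction s with
  | zero => exact ⟨0, by simp⟩
  | add s s' hs hs' =>
    obtain ⟨r, hr⟩ := hs
    obtain ⟨r', hr'⟩ := hs'
    exact ⟨r + r', by simp only [map_add, WithConv.toConv_add, add_mul, hr, hr']⟩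
  | tmul p x =>
    induction t with
    | zero => exact ⟨0, by simp⟩
    | add s s' hs hs' =>
      obtain ⟨r, hr⟩ := hs
      obtain ⟨r', hr'⟩ := hs'
      exact ⟨r + r', by simp only [map_add, WithConv.toConv_add, mul_add, hr, hr']⟩
    | tmul q y =>
      refine ⟨(WithConv.toConv p * WithConv.toConv q).ofConv ⊗ₜ (x * y), ?_⟩
      refine WithConv.ext (TensorProduct.ext' fun c h => ?_)
      change LinearMap.mul' R R (TensorProduct.map _ _
        (TensorProduct.tensorTensorTensorComm R C C H H
          (Coalgebra.comul (R := R) c ⊗ₜ Coalgebra.comul (R := R) h))) =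
        LinearMap.mul' R R (TensorProduct.map p q (Coalgebra.comul (R := R) c)) *
          LinearMap.mul' R R (TensorProduct.map x.1.ofConv y.1.ofConv
            (Coalgebra.comul (R := R) h))
      generalize Coalgebra.comul (R := R) c = d
      generalize Coalgebra.comul (R := R) h = k
      induction d with
      | zero => simp
      | add d d' hd hd' => simp only [TensorProduct.add_tmul, map_add, add_mul, hd, hd']
      | tmul c c' =>
        induction k with
        | zero => simp
        | add d d' hd hd' => simp only [TensorProduct.tmul_add, map_add, mul_add, hd, hd']
        | tmul k k' =>
          simp [tensorForm, formOf]
          ring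

/-- The `R`-submodule `C⁰ = Rat^{H°}(_H C^*)` of `C^*`, where `(h g)(c) = g(c h)`: the forms `g`
for which there is `∑ gᵢ ⊗ uᵢ ∈ C^* ⊗ H°` with `h g = ∑ gᵢ uᵢ(h)` for all `h`, that is,
`g(c h) = ∑ gᵢ(c) uᵢ(h)`. It is a subalgebra of the convolution algebra `C^*`. -/
noncomputable def ratDual (X : DoiKoppinen R H A C) : Subalgebra R (WithConv (C →ₗ[R] R)) where
  carrier := {g | ∃ t : Module.Dual R C ⊗[R] finiteDualAlg R H,
    g.ofConv ∘ₗ X.act.toLinearMap = tensorForm LinearMap.id (formOf (finiteDualAlg R H)) t}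
  add_mem' := by
    rintro f g ⟨s, hs⟩ ⟨t, ht⟩
    refine ⟨s + t, ?_⟩
    rw [map_add, ← hs, ← ht]
    rfl
  mul_mem' := by
    rintro f g ⟨s, hs⟩ ⟨t, ht⟩
    obtain ⟨r, hr⟩ := exists_tensorForm_mul s t
    refine ⟨r, ?_⟩
    rw [LinearMap.convMul_comp_coalgHom_distrib, hs, ht, hr]
  algebraMap_mem' := by
    intro r
    have h0 : (algebraMap R (WithConv (C →ₗ[R] R)) r).ofConv =
        r • (Coalgebra.counit : C →ₗ[R] R) := by
      ext x
      change (algebraMap R (WithConv (C →ₗ[R] R)) r) x = _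
      simp
    refine ⟨(r • (Coalgebra.counit : C →ₗ[R] R)) ⊗ₜ 1, TensorProduct.ext' fun c h => ?_⟩
    have h2 : Coalgebra.counit (R := R) (X.act (c ⊗ₜ[R] h)) =
        Coalgebra.counit (R := R) (c ⊗ₜ[R] h) := CoalgHomClass.counit_comp_apply X.act _
    have h3 : formOf (finiteDualAlg R H) 1 h = Coalgebra.counit (R := R) h := rfl
    rw [h0]
    simp [tensorForm, h2, h3]
    ring

variable (R H A) in
/-- The coalgebra structure of `A°`: `∑ f₁(a) f₂(b) = f(a b)` and `ε(f) = f(1)`. -/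
structure FiniteDualCoalgebra where
  coalg : Coalgebra R (finiteDual R A)
  comul_apply : ∀ f : finiteDual R A,
    tensorForm (finiteDual R A).subtype (finiteDual R A).subtype (coalg.comul f) =
      f.1 ∘ₗ LinearMap.mul' R A
  counit_apply : ∀ f : finiteDual R A, coalg.counit f = f.1 1

variable (R H) in
/-- The bialgebra structure of `H°`: the product is the convolution product of `H^*`, and
`∑ u₁(h) u₂(k) = u(h k)` and `ε(u) = u(1)`. -/
structure FiniteDualBialgebra where
  coalg : Coalgebra R (finiteDualAlg R H)
  comul_apply : ∀ u : finiteDualAlg R H,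
    tensorForm (formOf (finiteDualAlg R H)) (formOf (finiteDualAlg R H)) (coalg.comul u) =
      formOf (finiteDualAlg R H) u ∘ₗ LinearMap.mul' R H
  counit_apply : ∀ u : finiteDualAlg R H, coalg.counit u = formOf (finiteDualAlg R H) u 1
  counit_one : coalg.counit 1 = 1
  counit_mul : ∀ {u v : finiteDualAlg R H}, coalg.counit (u * v) = coalg.counit u * coalg.counit v
  comul_one : coalg.comul 1 = 1
  comul_mul : ∀ {u v : finiteDualAlg R H}, coalg.comul (u * v) = coalg.comul u * coalg.comul v

/-- The bialgebra `H°`. -/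
@[reducible] noncomputable def FiniteDualBialgebra.bialg (S : FiniteDualBialgebra R H) :
    Bialgebra R (finiteDualAlg R H) :=
  letI := S.coalg
  Bialgebra.mk' R _ S.counit_one S.counit_mul S.comul_one S.comul_mul

/-- The dual right-right Doi-Koppinen structure `(H°, C⁰, A°)` of `(H, A, C)`: all operations are
the transposes of those of `(H, A, C)`. The algebras `H°` and `C⁰` are subalgebras of the
convolution algebras `H^*` and `C^*`. -/
structure DualDK (X : DoiKoppinen R H A C) where
  dualA : FiniteDualCoalgebra R A
  dualH : FiniteDualBialgebra R H
  /-- the Doi-Koppinen structure `(H°, C⁰, A°)` -/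
  dk : letI := dualA.coalg; letI := dualH.bialg
    DoiKoppinen R (finiteDualAlg R H) (ratDual X) (finiteDual R A)
  /-- the coaction `C⁰ → C⁰ ⊗ H°`: `∑ g₀(c) g₁(h) = g(c h)` -/
  coact_apply : letI := dualA.coalg; letI := dualH.bialg
    ∀ g : ratDual X,
      tensorForm (formOf (ratDual X)) (formOf (finiteDualAlg R H)) (dk.coact g) =
        formOf (ratDual X) g ∘ₗ X.act.toLinearMap
  /-- the action `A° ⊗ H° → A°`: `(f u)(a) = ∑ f(a₀) u(a₁)` -/
  act_apply : letI := dualA.coalg; letI := dualH.bialg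
    ∀ (f : finiteDual R A) (u : finiteDualAlg R H),
      (dk.act (f ⊗ₜ u)).1 = tensorForm (finiteDual R A).subtype (formOf (finiteDualAlg R H))
        (f ⊗ₜ u) ∘ₗ X.coact.toLinearMap

end Dual

/-! Everything rests on one consequence of the α-condition, called `SeparatesTensors`: a tensor in
`N ⊗ A°` is zero as soon as all its slices, the elements of `N` obtained by evaluating the second
leg at elements of `A`, are zero. Over a noetherian ring evaluations separate `R^X ⊗ N`
(`eq_zero_of_forall_eval`), because the relations between finitely many elements of `N` form a
finitely generated module; purity embeds `A° ⊗ N` in `R^A ⊗ N`.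

Separation has two uses. For uniqueness, `tensorForm_injective` embeds tensor products of modules of
forms in `(V ⊗ W)^*`, so every axiom of the dual structure may be checked there, where it is the
transpose of an axiom of `(H, A, C)`. For existence, `SeparatesTensors.mem_range_rTensor` moves a
tensor into `M ⊗ U` once its slices come from `M`. This yields the comultiplication of `A°` and `H°`
(`exists_tensorForm_eq_comp_mul`) and the coaction of `C⁰` (`exists_tensorForm_eq_comp_act`):
finiteness of the bimodule span, or the definition of `C⁰`, gives a tensor with one leg in a module
that is too large, and the slices show that this leg can be corrected.

The module categories are compared for any structure whose coalgebra `C` is separated by `C^*`; for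
`A°` evaluations already suffice. The elements `c ↦ φ(c) 1` of `#ᵒᵖ(C, A)` act as the slices of the
coaction and the elements `c ↦ ε(c) a` act as `A`, so the `#ᵒᵖ(C, A)`-action determines the
Doi-Koppinen structure. Conversely, on a rational module separation makes the representing tensor
unique, and the multiplication rules between these two kinds of elements become coassociativity and
the compatibility condition. A Doi-Koppinen module `M` embeds in `M ⊗ C` by its coaction, and `M ⊗
C` is a quotient of a sum of copies of `A ⊗ C`; this gives `σ[A ⊗ C]`, the converse inclusion using
separation once more for submodules.

For morphisms, `DualDK.tensorForm_psi` identifies the dual entwining map with a restriction of the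
transpose of `ψ`, so the dual condition is the transpose of the given one. -/

/-! ### Separation of tensors by linear forms -/

section Separation

variable {R : Type u} [CommRing R]

/-- The map `N ⊗ U → N`, `n ⊗ x ↦ φ(x) n`. -/
noncomputable def tensorSlice (N : Type*) [AddCommMonoid N] [Module R N] {U : Type*}
    [AddCommMonoid U] [Module R U] (φ : Module.Dual R U) : N ⊗[R] U →ₗ[R] N :=
  (TensorProduct.rid R N).toLinearMap ∘ₗ φ.lTensor N

@[simp] lemma tensorSlice_tmul {N : Type*} [AddCommMonoid N] [Module R N] {U : Type*}
    [AddCommMonoid U] [Module R U] (φ : Module.Dual R U) (n : N) (x : U) :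
    tensorSlice N φ (n ⊗ₜ x) = φ x • n := by
  simp [tensorSlice]

lemma tensorSlice_rTensor {M N : Type*} [AddCommMonoid M] [Module R M] [AddCommMonoid N]
    [Module R N] {U : Type*} [AddCommMonoid U] [Module R U] (φ : Module.Dual R U)
    (p : M →ₗ[R] N) (t : M ⊗[R] U) :
    tensorSlice N φ (p.rTensor U t) = p (tensorSlice M φ t) := by
  induction t with
  | zero => simp
  | add s t hs ht => simp only [map_add, hs, ht]
  | tmul m x => simp

/-- A family of linear forms on `U`, indexed by `V`, separates tensors if an element of `N ⊗ U`
that is killed by all of them is zero. -/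
def SeparatesTensors {U V : Type*} [AddCommMonoid U] [Module R U] [AddCommMonoid V] [Module R V]
    (i : U →ₗ[R] Module.Dual R V) : Prop :=
  ∀ (N : Type u) [AddCommGroup N] [Module R N] (t : N ⊗[R] U),
    (∀ v, tensorSlice N (i.flip v) t = 0) → t = 0

section

variable {U V : Type*} [AddCommMonoid U] [Module R U] [AddCommMonoid V] [Module R V]
  {i : U →ₗ[R] Module.Dual R V}

/-- This removes the universe restriction on the test module: a tensor comes from a finitely
generated submodule, which is a quotient of some `R^n` and so has a copy in the universe of `R`. -/
lemma SeparatesTensors.eq_zero (hi : SeparatesTensors i) {M : Type*} [AddCommGroup M] [Module R M]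
    {t : M ⊗[R] U} (h : ∀ v, tensorSlice M (i.flip v) t = 0) : t = 0 := by
  obtain ⟨M', hfg, t', rfl⟩ : ∃ (M' : Submodule R M) (_ : M'.FG) (t' : M' ⊗[R] U),
      M'.subtype.rTensor U t' = t := by
    obtain ⟨M', hfin, ht⟩ := TensorProduct.exists_finite_submodule_left_of_setFinite {t}
      (Set.finite_singleton t)
    obtain ⟨t', ht'⟩ := ht rfl
    exact ⟨M', Module.Finite.iff_fg.mp hfin, t', ht'⟩
  have : Module.Finite R M' := Module.Finite.iff_fg.mpr hfg
  obtain ⟨n, f, hf⟩ := Module.Finite.exists_fin' R M'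
  have : Small.{u} M' := small_of_surjective hf
  let e := Shrink.linearEquiv R M'
  have h1 : ∀ v, tensorSlice M' (i.flip v) t' = 0 := fun v => by
    have := h v
    rw [tensorSlice_rTensor] at this
    exact Subtype.ext this
  have h2 : e.symm.toLinearMap.rTensor U t' = 0 := hi _ _ fun v => by
    rw [tensorSlice_rTensor, h1, map_zero]
  have h3 : t' = 0 := by
    have h4 := congrArg (e.toLinearMap.rTensor U) h2
    rw [← LinearMap.comp_apply, ← LinearMap.rTensor_comp] at h4
    simpa using h4
  rw [h3, map_zero]

lemma SeparatesTensors.ext (hi : SeparatesTensors i) {M : Type*} [AddCommMonoid M] [Module R M]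
    {s t : M ⊗[R] U} (h : ∀ v, tensorSlice M (i.flip v) s = tensorSlice M (i.flip v) t) :
    s = t := by
  let _ : AddCommGroup M := Module.addCommMonoidToAddCommGroup R
  exact sub_eq_zero.mp <| hi.eq_zero fun v => by rw [map_sub, h, sub_self]

/-- A tensor all of whose slices lie in the range of `p` lies in the range of `p ⊗ U`. -/
lemma SeparatesTensors.mem_range_rTensor (hi : SeparatesTensors i) {M P : Type*} [AddCommMonoid M]
    [Module R M] [AddCommGroup P] [Module R P] (p : M →ₗ[R] P) {t : P ⊗[R] U}
    (h : ∀ v, tensorSlice P (i.flip v) t ∈ LinearMap.range p) :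
    t ∈ LinearMap.range (p.rTensor U) := by
  let _ : AddCommGroup M := Module.addCommMonoidToAddCommGroup R
  let _ : AddCommGroup U := Module.addCommMonoidToAddCommGroup R
  -- By right exactness it is enough that the image of `t` in `coker p ⊗ U` is zero; its slices are
  -- the classes of those of `t`.
  have hex : Function.Exact p (LinearMap.range p).mkQ := fun x => by
    rw [Submodule.mkQ_apply, Submodule.Quotient.mk_eq_zero, LinearMap.mem_range, Set.mem_range]
  refine (rTensor_exact U hex (Submodule.mkQ_surjective _) t).mp (hi.eq_zero fun v => ?_)
  rw [tensorSlice_rTensor, Submodule.mkQ_apply, Submodule.Quotient.mk_eq_zero]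
  exact h v

/-- The forms `i.flip v` are among all forms on `U`. In this shape the property is intrinsic to `U`,
which is what the comparison of module categories asks of a coalgebra. -/
lemma SeparatesTensors.dual_eval (hi : SeparatesTensors i) :
    SeparatesTensors (Module.Dual.eval R U) :=
  fun _ _ _ _ h => hi.eq_zero fun v => h (i.flip v)

lemma SeparatesTensors.comp_equiv {U' : Type*} [AddCommMonoid U'] [Module R U']
    (hi : SeparatesTensors i) (e : U' ≃ₗ[R] U) : SeparatesTensors (i ∘ₗ e.toLinearMap) := by
  intro N _ _ t h
  have h1 : e.toLinearMap.lTensor N t = 0 := hi N _ fun v => by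
    have h2 : ∀ s : N ⊗[R] U', tensorSlice N (i.flip v) (e.toLinearMap.lTensor N s) =
        tensorSlice N ((i ∘ₗ e.toLinearMap).flip v) s := by
      intro s
      induction s with
      | zero => simp
      | add s s' hs hs' => simp only [map_add, hs, hs']
      | tmul n x => simp
    rw [h2, h]
  have h4 := congrArg (e.symm.toLinearMap.lTensor N) h1
  rw [← LinearMap.comp_apply, ← LinearMap.lTensor_comp] at h4
  simpa using h4

end

/-- Over a noetherian ring, the evaluations separate tensors with functions. -/
lemma eq_zero_of_forall_eval [IsNoetherianRing R] {X N : Type*} [AddCommGroup N] [Module R N]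
    (t : (X → R) ⊗[R] N)
    (h : ∀ x, TensorProduct.lid R N ((LinearMap.proj x : (X → R) →ₗ[R] R).rTensor N t) = 0) :
    t = 0 := by
  obtain ⟨n, g, m, rfl⟩ := TensorProduct.exists_sum_tmul_eq t
  -- The module of relations between the `m j` is finitely generated because `R` is noetherian. By
  -- hypothesis the values `(g j x)` form such a relation for each `x`.
  let K := LinearMap.ker (Fintype.linearCombination R m)
  obtain ⟨l, π, hπ⟩ := Module.Finite.exists_fin' R K
  have hK : ∀ x, (fun j => g j x) ∈ K := fun x => by
    have := h x
    simpa [K, Fintype.linearCombination_apply] using this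
  choose s hs using fun x => hπ ⟨_, hK x⟩
  -- Expressing each relation `(g j x)` in the generators `π (Pi.single a 1)` makes `g j` a
  -- combination, with constants independent of `x`, of the coefficient functions. Moving the
  -- constants across the tensor sign leaves relations between the `m j`.
  have hg : ∀ j, g j = ∑ a, (π (Pi.single a 1)).1 j • fun x => s x a := by
    intro j
    ext x
    have h1 := congrFun (congrArg Subtype.val (hs x)) j
    rw [pi_eq_sum_univ' (s x), map_sum] at h1
    simp only [map_smul, AddSubmonoidClass.coe_finsetSum, Finset.sum_apply, Submodule.coe_smul,
      Pi.smul_apply, smul_eq_mul] at h1 ⊢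
    rw [← h1]
    refine Finset.sum_congr rfl fun a _ => ?_
    rw [mul_comm]
  simp only [hg, TensorProduct.sum_tmul, TensorProduct.smul_tmul]
  rw [Finset.sum_comm]
  refine Finset.sum_eq_zero fun a _ => ?_
  rw [← TensorProduct.tmul_sum]
  have h1 := (π (Pi.single a 1)).2
  rw [LinearMap.mem_ker, Fintype.linearCombination_apply] at h1
  rw [h1, TensorProduct.tmul_zero]

/-- Purity carries the vanishing back from `R^A ⊗ N`, where evaluations at elements of `A` separate.
-/
lemma IsAlphaAlgebra.separatesTensors [IsNoetherianRing R] {A : Type vA} [Ring A] [Algebra R A]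
    (hA : IsAlphaAlgebra R A) : SeparatesTensors (finiteDual R A).subtype := by
  intro N _ _ t h
  let ι := LinearMap.ltoFun R A R R
  have hι : Function.Injective ι := fun f g hfg => LinearMap.ext fun x => congrFun hfg x
  let e : finiteDual R A ≃ₗ[R] (finiteDual R A).map ι :=
    (finiteDual R A).equivMapOfInjective ι hι
  have key : ((finiteDual R A).map ι).subtype.rTensor N
      (e.toLinearMap.rTensor N (TensorProduct.comm R N _ t)) = 0 := by
    refine eq_zero_of_forall_eval _ fun x => ?_
    rw [← h x]
    clear h
    induction t with
    | zero => simp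
    | add s t hs ht => simp only [map_add, hs, ht]
    | tmul n f => simp [e, ι]
  have h1 := hA N (key.trans (map_zero _).symm)
  have h4 := congrArg (e.symm.toLinearMap.rTensor N) h1
  rw [← LinearMap.comp_apply, ← LinearMap.rTensor_comp] at h4
  simpa using h4

lemma formOf_injective {C : Type vC} [AddCommGroup C] [Module R C] [Coalgebra R C]
    (S : Subalgebra R (WithConv (C →ₗ[R] R))) : Function.Injective (formOf S) := fun _ _ h =>
  Subtype.ext (WithConv.ofConv_injective h)

lemma range_formOf_finiteDualAlg [IsNoetherianRing R] (H : Type vH) [Ring H] [Bialgebra R H] :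
    LinearMap.range (formOf (finiteDualAlg R H)) = finiteDual R H := by
  ext f
  exact ⟨fun ⟨z, hz⟩ => hz ▸ z.2, fun hf => ⟨⟨WithConv.toConv f, hf⟩, rfl⟩⟩

lemma IsAlphaAlgebra.separatesTensors_formOf [IsNoetherianRing R] {H : Type vH} [Ring H]
    [Bialgebra R H] (hH : IsAlphaAlgebra R H) :
    SeparatesTensors (formOf (finiteDualAlg R H)) := by
  let e := (LinearEquiv.ofInjective _ (formOf_injective (finiteDualAlg R H))).trans
    (LinearEquiv.ofEq _ _ (range_formOf_finiteDualAlg H))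
  have h : formOf (finiteDualAlg R H) = (finiteDual R H).subtype ∘ₗ e.toLinearMap := rfl
  rw [h]
  exact hH.separatesTensors.comp_equiv e

end Separation

/-! ### Calculus of the maps `U ⊗ U' → (V ⊗ W)^*` -/

section TensorForm

variable {R : Type u} [CommRing R] {U U' U'' V V' V'' W W' W'' Z : Type*}
  [AddCommMonoid U] [Module R U] [AddCommMonoid U'] [Module R U'] [AddCommMonoid U''] [Module R U'']
  [AddCommMonoid V] [Module R V] [AddCommMonoid V'] [Module R V'] [AddCommMonoid V''] [Module R V'']
  [AddCommMonoid W] [Module R W] [AddCommMonoid W'] [Module R W'] [AddCommMonoid W''] [Module R W'']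

@[simp] lemma tensorForm_tmul (i : U →ₗ[R] Module.Dual R V) (j : U' →ₗ[R] Module.Dual R W)
    (x : U) (y : U') (v : V) (z : W) :
    tensorForm i j (x ⊗ₜ y) (v ⊗ₜ z) = i x v * j y z := by
  simp [tensorForm]

lemma tensorForm_apply_tmul (i : U →ₗ[R] Module.Dual R V) (j : U' →ₗ[R] Module.Dual R W)
    (t : U ⊗[R] U') (v : V) (z : W) :
    tensorForm i j t (v ⊗ₜ z) = i (tensorSlice U (j.flip z) t) v := by
  induction t with
  | zero => simp
  | add s t hs ht => simp only [map_add, LinearMap.add_apply, hs, ht]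
  | tmul x y => simp [mul_comm]

/-- The value at `v ⊗ z` is `i` of the slice at `z`, evaluated at `v`. Hence plain injectivity is
enough on the first leg, and no purity of `C⁰` in `R^C` is ever needed. -/
lemma tensorForm_injective {i : U →ₗ[R] Module.Dual R V} {j : U' →ₗ[R] Module.Dual R W}
    (hi : Function.Injective i) (hj : SeparatesTensors j) :
    Function.Injective (tensorForm i j) := fun s t h =>
  hj.ext fun z => hi <| LinearMap.ext fun v => by
    rw [← tensorForm_apply_tmul, ← tensorForm_apply_tmul, h]

lemma tensorForm_map (i : U →ₗ[R] Module.Dual R W) (j : U' →ₗ[R] Module.Dual R W')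
    (p : V →ₗ[R] U) (q : V' →ₗ[R] U') (t : V ⊗[R] V') :
    tensorForm i j (TensorProduct.map p q t) = tensorForm (i ∘ₗ p) (j ∘ₗ q) t := by
  simp [tensorForm, TensorProduct.map_comp]

lemma tensorForm_dualMap (i : U →ₗ[R] Module.Dual R V) (j : U' →ₗ[R] Module.Dual R V')
    (p : W →ₗ[R] V) (q : W' →ₗ[R] V') (t : U ⊗[R] U') :
    tensorForm (p.dualMap ∘ₗ i) (q.dualMap ∘ₗ j) t =
      tensorForm i j t ∘ₗ TensorProduct.map p q := by
  refine TensorProduct.ext' fun v z => ?_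
  simp only [LinearMap.comp_apply, TensorProduct.map_tmul]
  induction t with
  | zero => simp
  | add s t hs ht => simp only [map_add, LinearMap.add_apply, hs, ht]
  | tmul x y => simp

lemma tensorForm_assoc (i : U →ₗ[R] Module.Dual R V) (j : U' →ₗ[R] Module.Dual R V')
    (k : U'' →ₗ[R] Module.Dual R V'') (t : (U ⊗[R] U') ⊗[R] U'') :
    tensorForm i (tensorForm j k) (TensorProduct.assoc R U U' U'' t) ∘ₗ
      (TensorProduct.assoc R V V' V'').toLinearMap = tensorForm (tensorForm i j) k t := by
  refine TensorProduct.ext_threefold fun v v' v'' => ?_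
  induction t with
  | zero => simp
  | add s t hs ht => simp only [map_add, LinearMap.add_comp, LinearMap.add_apply, hs, ht]
  | tmul x y =>
    induction x with
    | zero => simp
    | add s t hs ht =>
      simp only [map_add, LinearMap.add_comp, LinearMap.add_apply, hs, ht, TensorProduct.add_tmul]
    | tmul x z => simp [mul_assoc]

lemma tensorForm_leftComm (i : U →ₗ[R] Module.Dual R V) (j : U' →ₗ[R] Module.Dual R V')
    (k : U'' →ₗ[R] Module.Dual R V'') (t : U ⊗[R] (U' ⊗[R] U'')) :
    tensorForm j (tensorForm i k) (TensorProduct.leftComm R U U' U'' t) =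
      tensorForm i (tensorForm j k) t ∘ₗ (TensorProduct.leftComm R V' V V'').toLinearMap := by
  refine TensorProduct.ext (LinearMap.ext fun v => TensorProduct.ext' fun v' v'' => ?_)
  change tensorForm j (tensorForm i k) (TensorProduct.leftComm R U U' U'' t) (v ⊗ₜ (v' ⊗ₜ v'')) =
    tensorForm i (tensorForm j k) t (v' ⊗ₜ (v ⊗ₜ v''))
  induction t with
  | zero => simp
  | add s t hs ht => simp only [map_add, LinearMap.add_apply, hs, ht]
  | tmul x y =>
    induction y with
    | zero => simp
    | add s t hs ht => simp only [map_add, LinearMap.add_apply, hs, ht, TensorProduct.tmul_add]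
    | tmul y z => simp; ring

lemma tensorForm_tensorTensorTensorComm [AddCommMonoid Z] [Module R Z]
    (i : U →ₗ[R] Module.Dual R V) (j : U' →ₗ[R] Module.Dual R V')
    (k : U'' →ₗ[R] Module.Dual R V'') (l : W →ₗ[R] Module.Dual R Z)
    (t : (U ⊗[R] U') ⊗[R] (U'' ⊗[R] W)) :
    tensorForm (tensorForm i k) (tensorForm j l)
        (TensorProduct.tensorTensorTensorComm R U U' U'' W t) =
      tensorForm (tensorForm i j) (tensorForm k l) t ∘ₗ
        (TensorProduct.tensorTensorTensorComm R V V'' V' Z).toLinearMap := by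
  refine TensorProduct.ext (TensorProduct.ext' fun v v'' => TensorProduct.ext' fun v' z => ?_)
  change tensorForm (tensorForm i k) (tensorForm j l)
      (TensorProduct.tensorTensorTensorComm R U U' U'' W t) ((v ⊗ₜ v'') ⊗ₜ (v' ⊗ₜ z)) =
    tensorForm (tensorForm i j) (tensorForm k l) t ((v ⊗ₜ v') ⊗ₜ (v'' ⊗ₜ z))
  induction t with
  | zero => simp
  | add s t hs ht => simp only [map_add, LinearMap.add_apply, hs, ht]
  | tmul x y =>
    induction x with
    | zero => simp
    | add s t hs ht => simp only [map_add, LinearMap.add_apply, hs, ht, TensorProduct.add_tmul]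
    | tmul x x' =>
      induction y with
      | zero => simp
      | add s t hs ht => simp only [map_add, LinearMap.add_apply, hs, ht, TensorProduct.tmul_add]
      | tmul y z => simp; ring

end TensorForm

/-! ### Restrictions of transposes, and factorization through injective maps -/

section Transpose

variable {R : Type u} [CommRing R]

/-- If `p` and `q` are restrictions of the transposes of `f` and `g`, then `p ⊗ q` is one of the
transpose of `f ⊗ g`. This is the rule by which an identity between dual operations is turned into
an identity between the original ones. -/
lemma tensorForm_map_of_comp_eq {U U' V V' W W' Z Z' : Type*}
    [AddCommMonoid U] [Module R U] [AddCommMonoid U'] [Module R U']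
    [AddCommMonoid V] [Module R V] [AddCommMonoid V'] [Module R V']
    [AddCommMonoid W] [Module R W] [AddCommMonoid W'] [Module R W']
    [AddCommMonoid Z] [Module R Z] [AddCommMonoid Z'] [Module R Z']
    {i : U →ₗ[R] Module.Dual R W} {j : U' →ₗ[R] Module.Dual R W'}
    {k : V →ₗ[R] Module.Dual R Z} {l : V' →ₗ[R] Module.Dual R Z'}
    {p : V →ₗ[R] U} {q : V' →ₗ[R] U'} {f : W →ₗ[R] Z} {g : W' →ₗ[R] Z'}
    (h : i ∘ₗ p = f.dualMap ∘ₗ k) (h' : j ∘ₗ q = g.dualMap ∘ₗ l) (t : V ⊗[R] V') :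
    tensorForm i j (TensorProduct.map p q t) = tensorForm k l t ∘ₗ TensorProduct.map f g := by
  rw [tensorForm_map, h, h', tensorForm_dualMap]

lemma tensorForm_rTensor_of_comp_eq {U U' V W W' Z : Type*}
    [AddCommMonoid U] [Module R U] [AddCommMonoid U'] [Module R U']
    [AddCommMonoid V] [Module R V] [AddCommMonoid W] [Module R W] [AddCommMonoid W'] [Module R W']
    [AddCommMonoid Z] [Module R Z]
    {i : U →ₗ[R] Module.Dual R W} (j : U' →ₗ[R] Module.Dual R W')
    {k : V →ₗ[R] Module.Dual R Z} {p : V →ₗ[R] U} {f : W →ₗ[R] Z}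
    (h : i ∘ₗ p = f.dualMap ∘ₗ k) (t : V ⊗[R] U') :
    tensorForm i j (p.rTensor U' t) = tensorForm k j t ∘ₗ f.rTensor W' :=
  have h' : j ∘ₗ LinearMap.id = (LinearMap.id : W' →ₗ[R] W').dualMap ∘ₗ j := by
    rw [LinearMap.dualMap_id]; rfl
  tensorForm_map_of_comp_eq h h' t

lemma tensorForm_lTensor_of_comp_eq {U U' V' W W' Z' : Type*}
    [AddCommMonoid U] [Module R U] [AddCommMonoid U'] [Module R U']
    [AddCommMonoid V'] [Module R V'] [AddCommMonoid W] [Module R W] [AddCommMonoid W'] [Module R W']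
    [AddCommMonoid Z'] [Module R Z']
    (i : U →ₗ[R] Module.Dual R W) {j : U' →ₗ[R] Module.Dual R W'}
    {l : V' →ₗ[R] Module.Dual R Z'} {q : V' →ₗ[R] U'} {g : W' →ₗ[R] Z'}
    (h : j ∘ₗ q = g.dualMap ∘ₗ l) (t : U ⊗[R] V') :
    tensorForm i j (q.lTensor U t) = tensorForm i l t ∘ₗ g.lTensor W :=
  have h' : i ∘ₗ LinearMap.id = (LinearMap.id : W →ₗ[R] W).dualMap ∘ₗ i := by
    rw [LinearMap.dualMap_id]; rfl
  tensorForm_map_of_comp_eq h' h t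

lemma tensorForm_assoc_injective {U U' U'' V V' V'' : Type*} [AddCommMonoid U] [Module R U]
    [AddCommMonoid U'] [Module R U'] [AddCommMonoid U''] [Module R U''] [AddCommMonoid V]
    [Module R V] [AddCommMonoid V'] [Module R V'] [AddCommMonoid V''] [Module R V'']
    {i : U →ₗ[R] Module.Dual R V} {j : U' →ₗ[R] Module.Dual R V'}
    {k : U'' →ₗ[R] Module.Dual R V''} (hi : Function.Injective i) (hj : SeparatesTensors j)
    (hk : SeparatesTensors k) : Function.Injective (tensorForm i (tensorForm j k)) := by
  intro s t h
  obtain ⟨s, rfl⟩ := (TensorProduct.assoc R U U' U'').surjective s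
  obtain ⟨t, rfl⟩ := (TensorProduct.assoc R U U' U'').surjective t
  refine congrArg _ (tensorForm_injective (tensorForm_injective hi hj) hk ?_)
  rw [← tensorForm_assoc, h, tensorForm_assoc]

/-- The counits of the duals are evaluations at a unit element, so contracting with a counit means
inserting that element. The counit axioms reduce to unit laws in this way. -/
lemma apply_rid_lTensor {U U' V V' : Type*} [AddCommMonoid U] [Module R U] [AddCommMonoid U']
    [Module R U'] [AddCommMonoid V] [Module R V] [AddCommMonoid V'] [Module R V']
    (i : U →ₗ[R] Module.Dual R V) {j : U' →ₗ[R] Module.Dual R V'} {e : U' →ₗ[R] R} {z : V'}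
    (h : ∀ x, e x = j x z) (t : U ⊗[R] U') (v : V) :
    i (TensorProduct.rid R U (e.lTensor U t)) v = tensorForm i j t (v ⊗ₜ z) := by
  have : e = j.flip z := LinearMap.ext h
  rw [tensorForm_apply_tmul, this]
  rfl

lemma apply_lid_rTensor {U U' V V' : Type*} [AddCommMonoid U] [Module R U] [AddCommMonoid U']
    [Module R U'] [AddCommMonoid V] [Module R V] [AddCommMonoid V'] [Module R V']
    {i : U →ₗ[R] Module.Dual R V} (j : U' →ₗ[R] Module.Dual R V') {e : U →ₗ[R] R} {v : V}
    (h : ∀ x, e x = i x v) (t : U ⊗[R] U') (z : V') :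
    j (TensorProduct.lid R U' (e.rTensor U' t)) z = tensorForm i j t (v ⊗ₜ z) := by
  induction t with
  | zero => simp
  | add s t hs ht => simp only [map_add, LinearMap.add_apply, hs, ht]
  | tmul x y => simp [h]

/-- The factorization of a linear map through an injective one. -/
noncomputable def liftOfInjective {X Y Z : Type*} [AddCommMonoid X] [Module R X] [AddCommMonoid Y]
    [Module R Y] [AddCommMonoid Z] [Module R Z] (T : X →ₗ[R] Y) (hT : Function.Injective T)
    (f : Z →ₗ[R] Y) (h : ∀ z, ∃ x, T x = f z) : Z →ₗ[R] X :=
  (LinearEquiv.ofInjective T hT).symm.toLinearMap ∘ₗ f.codRestrict (LinearMap.range T) h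

lemma apply_liftOfInjective {X Y Z : Type*} [AddCommMonoid X] [Module R X] [AddCommMonoid Y]
    [Module R Y] [AddCommMonoid Z] [Module R Z] (T : X →ₗ[R] Y) (hT : Function.Injective T)
    (f : Z →ₗ[R] Y) (h : ∀ z, ∃ x, T x = f z) (z : Z) : T (liftOfInjective T hT f h z) = f z :=
  congrArg Subtype.val ((LinearEquiv.ofInjective T hT).apply_symm_apply
    (f.codRestrict (LinearMap.range T) h z))

end Transpose

/-! ### The coalgebra structure of the finite dual -/

section FiniteDual

variable {R : Type u} [CommRing R] {A : Type vA} [Ring A] [Algebra R A]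

/-- `A f A` is stable under translation on both sides; as a consequence `A°` contains `A f A` for
each of its elements `f`. -/
lemma bimoduleSpan_le {f g : Module.Dual R A} (hg : g ∈ bimoduleSpan f) :
    bimoduleSpan g ≤ bimoduleSpan f := by
  refine Submodule.span_le.mpr ?_
  rintro _ ⟨⟨a, b⟩, rfl⟩
  let T : Module.Dual R A →ₗ[R] Module.Dual R A :=
    (LinearMap.mulLeft R a ∘ₗ LinearMap.mulRight R b).dualMap
  have h : bimoduleSpan f ≤ (bimoduleSpan f).comap T := by
    refine Submodule.span_le.mpr ?_
    rintro _ ⟨⟨c, d⟩, rfl⟩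
    refine Submodule.subset_span ⟨(c * a, b * d), ?_⟩
    ext x
    simp [T, mul_assoc]
  exact h hg

lemma mem_bimoduleSpan (f : Module.Dual R A) (a b : A) :
    f ∘ₗ LinearMap.mulLeft R a ∘ₗ LinearMap.mulRight R b ∈ bimoduleSpan f :=
  Submodule.subset_span ⟨(a, b), rfl⟩

lemma comp_mulLeft_mem_bimoduleSpan (f : Module.Dual R A) (a : A) :
    f ∘ₗ LinearMap.mulLeft R a ∈ bimoduleSpan f := by
  simpa using mem_bimoduleSpan f a 1

lemma comp_mulRight_mem_bimoduleSpan (f : Module.Dual R A) (b : A) :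
    f ∘ₗ LinearMap.mulRight R b ∈ bimoduleSpan f := by
  simpa using mem_bimoduleSpan f 1 b

variable [IsNoetherianRing R]

lemma bimoduleSpan_le_finiteDual {f : Module.Dual R A} (hf : f ∈ finiteDual R A) :
    bimoduleSpan f ≤ finiteDual R A := fun _ hg =>
  Submodule.FG.of_le (T := bimoduleSpan f) hf (bimoduleSpan_le hg)

variable {U : Type*} [AddCommMonoid U] [Module R U] {i : U →ₗ[R] Module.Dual R A}

/-- Finite generation of `A f A` gives `f(a b) = ∑ rₖ(a) gₖ(b)` with `gₖ ∈ A°` and mere functions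
`rₖ`, a tensor in `R^A ⊗ A°`. Its slice at `b` is the translate `a ↦ f(a b)`, which lies in `A°`, so
separation brings the first leg into `A°` as well. -/
lemma exists_tensorForm_eq_comp_mul (hs : SeparatesTensors i)
    (hr : LinearMap.range i = finiteDual R A) (x : U) :
    ∃ t : U ⊗[R] U, tensorForm i i t = i x ∘ₗ LinearMap.mul' R A := by
  have hx : i x ∈ finiteDual R A := hr ▸ ⟨x, rfl⟩
  have : Module.Finite R (bimoduleSpan (i x)) := Module.Finite.iff_fg.mpr hx
  obtain ⟨n, π, hπ⟩ := Module.Finite.exists_fin' R (bimoduleSpan (i x))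
  -- Coordinates of the translate `b ↦ f(a b)` in a finite generating family; they are chosen for
  -- each `a` separately and need not be linear in `a`.
  choose r hr' using fun a : A => hπ ⟨_, comp_mulLeft_mem_bimoduleSpan (i x) a⟩
  have hg : ∀ k : Fin n, ∃ y, i y = (π (Pi.single k 1)).1 := fun k => by
    have h := bimoduleSpan_le_finiteDual hx (π (Pi.single k 1)).2
    rwa [← hr] at h
  choose g hg using hg
  have hrg : ∀ a b, ∑ k, r a k * i (g k) b = i x (a * b) := fun a b => by
    have h1 := congrArg (fun q => q.1 b) (hr' a)
    simp only [LinearMap.comp_apply, LinearMap.mulLeft_apply] at h1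
    rw [← h1, LinearMap.congr_arg (f := π) (pi_eq_sum_univ' (r a)), map_sum]
    simp [hg]
  let p : U →ₗ[R] (A → R) := LinearMap.ltoFun R A R R ∘ₗ i
  let t : (A → R) ⊗[R] U := ∑ k, (fun a => r a k) ⊗ₜ g k
  have ht : ∀ b, tensorSlice (A → R) (i.flip b) t = fun a => i x (a * b) := fun b => by
    ext a
    rw [← hrg]
    simp [t, mul_comm]
  -- Every slice of `t` is a translate of an element of `A°`, so `t` can be replaced by a tensor
  -- over `A°`.
  obtain ⟨t', ht'⟩ := hs.mem_range_rTensor p (t := t) fun b => by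
    rw [ht]
    have h := bimoduleSpan_le_finiteDual hx (comp_mulRight_mem_bimoduleSpan (i x) b)
    rw [← hr] at h
    obtain ⟨y, hy⟩ := h
    refine ⟨y, ?_⟩
    ext a
    exact LinearMap.congr_fun hy a
  refine ⟨t', TensorProduct.ext' fun a b => ?_⟩
  rw [tensorForm_apply_tmul]
  have h := congrFun (ht b) a
  rw [← ht', tensorSlice_rTensor] at h
  simpa [p] using h

/-- The map `U → U ⊗ U` transposed to the multiplication. -/
noncomputable def transposeComul (hi : Function.Injective i)
    (hs : SeparatesTensors i) (hr : LinearMap.range i = finiteDual R A) : U →ₗ[R] U ⊗[R] U :=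
  liftOfInjective (tensorForm i i) (tensorForm_injective hi hs)
    ((LinearMap.mul' R A).dualMap ∘ₗ i) (exists_tensorForm_eq_comp_mul hs hr)

lemma tensorForm_transposeComul (hi : Function.Injective i) (hs : SeparatesTensors i)
    (hr : LinearMap.range i = finiteDual R A) (x : U) :
    tensorForm i i (transposeComul hi hs hr x) = i x ∘ₗ LinearMap.mul' R A :=
  apply_liftOfInjective (tensorForm i i) _ ((LinearMap.mul' R A).dualMap ∘ₗ i) _ x

/-- The coalgebra structure on a module of representative forms that is transposed to the algebra
structure. -/
@[reducible] noncomputable def transposeCoalgebra (hi : Function.Injective i)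
    (hs : SeparatesTensors i) (hr : LinearMap.range i = finiteDual R A) : Coalgebra R U :=
  have hx : ∀ x, tensorForm i i (transposeComul hi hs hr x) = i x ∘ₗ LinearMap.mul' R A :=
    tensorForm_transposeComul hi hs hr
  have hΔ : tensorForm i i ∘ₗ transposeComul hi hs hr = (LinearMap.mul' R A).dualMap ∘ₗ i :=
    LinearMap.ext hx
  { comul := transposeComul hi hs hr
    counit := i.flip 1
    coassoc := LinearMap.ext fun x => tensorForm_assoc_injective hi hs hs <| by
      -- Seen as trilinear forms, the two sides are `f((a b) c)` and `f(a (b c))`.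
      rw [← LinearMap.cancel_right (TensorProduct.assoc R A A A).surjective]
      simp only [LinearMap.comp_apply]
      erw [tensorForm_assoc]
      rw [tensorForm_rTensor_of_comp_eq i hΔ, tensorForm_lTensor_of_comp_eq i hΔ, hx]
      refine TensorProduct.ext_threefold fun a b c => ?_
      simp [mul_assoc]
    rTensor_counit_comp_comul := LinearMap.ext fun x =>
      (TensorProduct.lid R U).injective <| hi <| LinearMap.ext fun a => by
        simp only [LinearMap.comp_apply]
        rw [apply_lid_rTensor (i := i) i (v := 1) (fun _ => rfl), hx]
        simp
    lTensor_counit_comp_comul := LinearMap.ext fun x =>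
      (TensorProduct.rid R U).injective <| hi <| LinearMap.ext fun a => by
        simp only [LinearMap.comp_apply]
        rw [apply_rid_lTensor (j := i) i (z := 1) (fun _ => rfl), hx]
        simp }

end FiniteDual

/-! ### The dual Doi-Koppinen structure -/

section Convolution

variable {R : Type u} [CommRing R] {C : Type vC} {D : Type vD} [AddCommGroup C] [Module R C]
  [Coalgebra R C] [AddCommGroup D] [Module R D] [Coalgebra R D]

lemma formOf_one_apply (S : Subalgebra R (WithConv (C →ₗ[R] R))) (c : C) :
    formOf S 1 c = Coalgebra.counit (R := R) c := rfl

lemma formOf_mul (S : Subalgebra R (WithConv (C →ₗ[R] R))) (f g : S) :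
    formOf S (f * g) =
      (WithConv.toConv (formOf S f) * WithConv.toConv (formOf S g)).ofConv := rfl

lemma tensorForm_one (S : Subalgebra R (WithConv (C →ₗ[R] R)))
    (S' : Subalgebra R (WithConv (D →ₗ[R] R))) :
    tensorForm (formOf S) (formOf S') 1 = Coalgebra.counit (R := R) (A := C ⊗[R] D) := by
  refine TensorProduct.ext' fun c d => ?_
  rw [Algebra.TensorProduct.one_def, tensorForm_tmul, formOf_one_apply, formOf_one_apply]
  simp [mul_comm]

/-- The embedding in `(C ⊗ D)^*` is multiplicative for the convolution of the tensor product
coalgebra, so a map into `S ⊗ S'` can be tested for multiplicativity on forms. -/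
lemma tensorForm_mul (S : Subalgebra R (WithConv (C →ₗ[R] R)))
    (S' : Subalgebra R (WithConv (D →ₗ[R] R))) (s t : S ⊗[R] S') :
    tensorForm (formOf S) (formOf S') (s * t) =
      (WithConv.toConv (tensorForm (formOf S) (formOf S') s) *
        WithConv.toConv (tensorForm (formOf S) (formOf S') t)).ofConv := by
  induction s with
  | zero => simp
  | add s s' hs hs' =>
    rw [add_mul, map_add, hs, hs', map_add, WithConv.toConv_add, add_mul, WithConv.ofConv_add]
  | tmul x x' =>
    induction t with
    | zero => simp
    | add t t' ht ht' =>
      rw [mul_add, map_add, ht, ht', map_add, WithConv.toConv_add, mul_add, WithConv.ofConv_add]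
    | tmul y y' =>
      refine TensorProduct.ext' fun c d => ?_
      rw [Algebra.TensorProduct.tmul_mul_tmul, tensorForm_tmul]
      change LinearMap.mul' R R (TensorProduct.map (formOf S x) (formOf S y)
          (Coalgebra.comul (R := R) c)) * LinearMap.mul' R R (TensorProduct.map (formOf S' x')
            (formOf S' y') (Coalgebra.comul (R := R) d)) =
        LinearMap.mul' R R (TensorProduct.map _ _
        (TensorProduct.tensorTensorTensorComm R C C D D
          (Coalgebra.comul (R := R) c ⊗ₜ Coalgebra.comul (R := R) d)))
      generalize Coalgebra.comul (R := R) c = p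
      generalize Coalgebra.comul (R := R) d = q
      induction p with
      | zero => simp
      | add p p' hp hp' => simp only [TensorProduct.add_tmul, map_add, add_mul, hp, hp']
      | tmul c c' =>
        induction q with
        | zero => simp
        | add q q' hq hq' => simp only [TensorProduct.tmul_add, map_add, mul_add, hq, hq']
        | tmul d d' => simp; ring

lemma formOf_mul_eq_tensorForm_comp_comul (S : Subalgebra R (WithConv (C →ₗ[R] R))) (f g : S) :
    formOf S (f * g) = tensorForm (formOf S) (formOf S) (f ⊗ₜ g) ∘ₗ Coalgebra.comul := by
  ext c
  change LinearMap.mul' R R (TensorProduct.map _ _ (Coalgebra.comul (R := R) c)) =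
    tensorForm (formOf S) (formOf S) (f ⊗ₜ g) (Coalgebra.comul (R := R) c)
  generalize Coalgebra.comul (R := R) c = d
  induction d with
  | zero => simp
  | add d d' hd hd' => simp only [map_add, hd, hd']
  | tmul c c' => simp [formOf]

end Convolution

/-! ### The coalgebra `A°`, the bialgebra `H°` and the transposed action and coaction -/

section DualStructure

variable {R : Type u} [CommRing R] [IsNoetherianRing R] {H : Type vH} {A : Type vA} {C : Type vC}
  [Ring H] [Bialgebra R H] [Ring A] [Algebra R A] [AddCommGroup C] [Module R C] [Coalgebra R C]

/-- The coalgebra `A°`. -/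
noncomputable def IsAlphaAlgebra.finiteDualCoalgebra (hA : IsAlphaAlgebra R A) :
    FiniteDualCoalgebra R A where
  coalg := transposeCoalgebra (finiteDual R A).injective_subtype hA.separatesTensors
    (finiteDual R A).range_subtype
  comul_apply := tensorForm_transposeComul (finiteDual R A).injective_subtype hA.separatesTensors
    (finiteDual R A).range_subtype
  counit_apply _ := rfl

/-- The bialgebra `H°`. -/
noncomputable def IsAlphaAlgebra.finiteDualBialgebra (hH : IsAlphaAlgebra R H) :
    FiniteDualBialgebra R H where
  coalg := transposeCoalgebra (formOf_injective _) hH.separatesTensors_formOf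
    (range_formOf_finiteDualAlg H)
  comul_apply := tensorForm_transposeComul (formOf_injective _) hH.separatesTensors_formOf
    (range_formOf_finiteDualAlg H)
  counit_apply _ := rfl
  counit_one := by
    change formOf (finiteDualAlg R H) 1 1 = 1
    rw [formOf_one_apply, Bialgebra.counit_one]
  counit_mul {u v} := by
    change formOf (finiteDualAlg R H) (u * v) 1 =
      formOf (finiteDualAlg R H) u 1 * formOf (finiteDualAlg R H) v 1
    change LinearMap.mul' R R (TensorProduct.map (formOf (finiteDualAlg R H) u)
      (formOf (finiteDualAlg R H) v) (Coalgebra.comul (R := R) 1)) = _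
    rw [Bialgebra.comul_one, Algebra.TensorProduct.one_def]
    simp
  comul_one := by
    refine tensorForm_injective (formOf_injective (finiteDualAlg R H))
      hH.separatesTensors_formOf ?_
    refine (tensorForm_transposeComul (formOf_injective _) hH.separatesTensors_formOf
      (range_formOf_finiteDualAlg H) 1).trans ?_
    rw [tensorForm_one]
    refine TensorProduct.ext' fun h k => ?_
    simp [formOf_one_apply, mul_comm]
  comul_mul {u v} := by
    refine tensorForm_injective (formOf_injective (finiteDualAlg R H))
      hH.separatesTensors_formOf ?_
    have key := tensorForm_transposeComul (formOf_injective _) hH.separatesTensors_formOf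
      (range_formOf_finiteDualAlg H)
    refine (key (u * v)).trans ?_
    rw [tensorForm_mul]
    refine Eq.trans ?_ (congrArg₂ (fun p q => (WithConv.toConv p * WithConv.toConv q).ofConv)
      (key u) (key v)).symm
    -- Multiplication `H ⊗ H → H` is a coalgebra map, so composing with it respects convolution.
    exact LinearMap.convMul_comp_coalgHom_distrib _ _ (Bialgebra.mulCoalgHom R H)

namespace DoiKoppinen

variable (X : DoiKoppinen R H A C)

/-- The definition of `C⁰` provides `t ∈ C^* ⊗ H°`. Its slice at `h` is `hg : c ↦ g(c h)`, and
`(hg)(c k) = g(c (k h))` is represented by `t` with the second leg translated by `h`. So the slices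
lie in `C⁰`, and separation by `H` moves the first leg there. -/
lemma exists_tensorForm_eq_comp_act (hH : IsAlphaAlgebra R H) (g : ratDual X) :
    ∃ t : ratDual X ⊗[R] finiteDualAlg R H,
      tensorForm (formOf (ratDual X)) (formOf (finiteDualAlg R H)) t =
        formOf (ratDual X) g ∘ₗ X.act.toLinearMap := by
  obtain ⟨t, ht⟩ := g.2
  have hshift : ∀ (s : Module.Dual R C ⊗[R] finiteDualAlg R H) (h : H),
      ∃ s' : Module.Dual R C ⊗[R] finiteDualAlg R H, ∀ (c : C) (k : H),
        tensorForm LinearMap.id (formOf (finiteDualAlg R H)) s' (c ⊗ₜ k) =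
          tensorForm LinearMap.id (formOf (finiteDualAlg R H)) s (c ⊗ₜ (k * h)) := by
    intro s h
    induction s with
    | zero => exact ⟨0, by simp⟩
    | add s t hs ht =>
      obtain ⟨s', hs'⟩ := hs
      obtain ⟨t', ht'⟩ := ht
      exact ⟨s' + t', fun c k => by simp only [map_add, LinearMap.add_apply, hs', ht']⟩
    | tmul p x =>
      have hx : formOf (finiteDualAlg R H) x ∘ₗ LinearMap.mulRight R h ∈
          LinearMap.range (formOf (finiteDualAlg R H)) := by
        rw [range_formOf_finiteDualAlg]
        exact bimoduleSpan_le_finiteDual x.2 (comp_mulRight_mem_bimoduleSpan _ h)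
      obtain ⟨y, hy⟩ := hx
      exact ⟨p ⊗ₜ y, fun c k => by simp [hy]⟩
  have hg : ∀ c h, tensorForm LinearMap.id (formOf (finiteDualAlg R H)) t (c ⊗ₜ h) =
      g.1.ofConv (X.act (c ⊗ₜ h)) := fun c h => (LinearMap.congr_fun ht (c ⊗ₜ h)).symm
  obtain ⟨t', rfl⟩ := hH.separatesTensors_formOf.mem_range_rTensor (formOf (ratDual X)) (t := t)
    fun h => by
      obtain ⟨s', hs'⟩ := hshift t h
      refine ⟨⟨WithConv.toConv (tensorSlice _ ((formOf (finiteDualAlg R H)).flip h) t), s',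
        TensorProduct.ext' fun c k => ?_⟩, rfl⟩
      rw [hs', hg, X.act_mul, ← hg, tensorForm_apply_tmul]
      rfl
  refine ⟨t', Eq.trans ?_ ht.symm⟩
  exact (tensorForm_rTensor_of_comp_eq (i := LinearMap.id) (f := LinearMap.id) _
    (by rw [LinearMap.dualMap_id]) t').trans (by simp) |>.symm

/-- The coaction `C⁰ → C⁰ ⊗ H°`, `∑ g₀(c) g₁(h) = g(c h)`. -/
noncomputable def transposeAct (hH : IsAlphaAlgebra R H) :
    ratDual X →ₗ[R] ratDual X ⊗[R] finiteDualAlg R H :=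
  liftOfInjective (tensorForm (formOf (ratDual X)) (formOf (finiteDualAlg R H)))
    (tensorForm_injective (formOf_injective _) hH.separatesTensors_formOf)
    (X.act.toLinearMap.dualMap ∘ₗ formOf (ratDual X)) (X.exists_tensorForm_eq_comp_act hH)

lemma tensorForm_transposeAct (hH : IsAlphaAlgebra R H) (g : ratDual X) :
    tensorForm (formOf (ratDual X)) (formOf (finiteDualAlg R H)) (X.transposeAct hH g) =
      formOf (ratDual X) g ∘ₗ X.act.toLinearMap :=
  apply_liftOfInjective (tensorForm (formOf (ratDual X)) (formOf (finiteDualAlg R H))) _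
    (X.act.toLinearMap.dualMap ∘ₗ formOf (ratDual X)) _ g

/-- The algebra map `C⁰ → C⁰ ⊗ H°`, `∑ g₀(c) g₁(h) = g(c h)`. -/
noncomputable def transposeActAlgHom (hH : IsAlphaAlgebra R H) :
    ratDual X →ₐ[R] ratDual X ⊗[R] finiteDualAlg R H :=
  have hinj := tensorForm_injective (formOf_injective (ratDual X)) hH.separatesTensors_formOf
  AlgHom.ofLinearMap (X.transposeAct hH)
    (hinj <| by
      rw [tensorForm_transposeAct, tensorForm_one]
      exact X.act.counit_comp)
    fun f g => hinj <| by
      rw [tensorForm_transposeAct, tensorForm_mul, tensorForm_transposeAct,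
        tensorForm_transposeAct, formOf_mul, LinearMap.convMul_comp_coalgHom_distrib]

/-- Since the coaction is multiplicative, the translates of `f u` are sums of products of translates
of `f` and of `u`. They stay in the image of two finitely generated bimodule spans under a bilinear
map. -/
lemma tensorForm_comp_coact_mem_finiteDual (t : finiteDual R A ⊗[R] finiteDualAlg R H) :
    tensorForm (finiteDual R A).subtype (formOf (finiteDualAlg R H)) t ∘ₗ X.coact.toLinearMap ∈
      finiteDual R A := by
  induction t with
  | zero => simp
  | add s t hs ht =>
    rw [map_add, LinearMap.add_comp]
    exact add_mem hs ht
  | tmul f x =>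
    let T : Module.Dual R A →ₗ[R] Module.Dual R H →ₗ[R] Module.Dual R A :=
      (TensorProduct.mk R _ _).compr₂
        (X.coact.toLinearMap.dualMap ∘ₗ TensorProduct.dualDistrib R A H)
    refine Submodule.FG.of_le
      (T := Submodule.map₂ T (bimoduleSpan f.1) (bimoduleSpan (formOf (finiteDualAlg R H) x)))
      (Submodule.FG.map₂ _ f.2 x.2) ?_
    refine Submodule.span_le.mpr ?_
    rintro _ ⟨⟨a, b⟩, rfl⟩
    -- Arbitrary `p` and `q` replace the coactions of `a` and `b`, so that both can be reduced to
    -- pure tensors.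
    have key : ∀ p q : A ⊗[R] H, TensorProduct.dualDistrib R A H
        (f.1 ⊗ₜ formOf (finiteDualAlg R H) x) ∘ₗ
          LinearMap.mulLeft R p ∘ₗ LinearMap.mulRight R q ∘ₗ X.coact.toLinearMap ∈
        Submodule.map₂ T (bimoduleSpan f.1) (bimoduleSpan (formOf (finiteDualAlg R H) x)) := by
      intro p q
      induction p with
      | zero => simp
      | add p p' hp hp' =>
        have : LinearMap.mulLeft R (p + p') = LinearMap.mulLeft R p + LinearMap.mulLeft R p' :=
          LinearMap.ext fun z => add_mul p p' z
        rw [this, LinearMap.add_comp, LinearMap.comp_add]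
        exact add_mem hp hp'
      | tmul y h =>
        induction q with
        | zero => simp
        | add q q' hq hq' =>
          have : LinearMap.mulRight R (q + q') =
              LinearMap.mulRight R q + LinearMap.mulRight R q' :=
            LinearMap.ext fun z => mul_add z q q'
          rw [this, LinearMap.add_comp, LinearMap.comp_add, LinearMap.comp_add]
          exact add_mem hq hq'
        | tmul z k =>
          convert Submodule.apply_mem_map₂ T (mem_bimoduleSpan f.1 y z)
            (mem_bimoduleSpan (formOf (finiteDualAlg R H) x) h k) using 1
          ext a
          simp only [T, LinearMap.comp_apply, LinearMap.compr₂_apply, TensorProduct.mk_apply,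
            LinearMap.dualMap_apply]
          generalize X.coact.toLinearMap a = s
          induction s with
          | zero => simp
          | add s t hs ht => simp only [map_add, hs, ht]
          | tmul b l => simp
    have h : (tensorForm (finiteDual R A).subtype (formOf (finiteDualAlg R H)) (f ⊗ₜ[R] x) ∘ₗ
        X.coact.toLinearMap) ∘ₗ LinearMap.mulLeft R a ∘ₗ LinearMap.mulRight R b =
        TensorProduct.dualDistrib R A H (f.1 ⊗ₜ formOf (finiteDualAlg R H) x) ∘ₗ
          LinearMap.mulLeft R (X.coact a) ∘ₗ LinearMap.mulRight R (X.coact b) ∘ₗ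
            X.coact.toLinearMap := by
      ext c
      simp [tensorForm]
    change _ ∈ Submodule.map₂ T _ _
    exact (congrArg (· ∈ Submodule.map₂ T _ _) h).mpr (key (X.coact a) (X.coact b))

/-- The action `A° ⊗ H° → A°`, `(f u)(a) = ∑ f(a₀) u(a₁)`. -/
noncomputable def transposeCoact :
    finiteDual R A ⊗[R] finiteDualAlg R H →ₗ[R] finiteDual R A :=
  (X.coact.toLinearMap.dualMap ∘ₗ
    tensorForm (finiteDual R A).subtype (formOf (finiteDualAlg R H))).codRestrict (finiteDual R A)
      X.tensorForm_comp_coact_mem_finiteDual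

lemma subtype_comp_transposeCoact : (finiteDual R A).subtype ∘ₗ X.transposeCoact =
    X.coact.toLinearMap.dualMap ∘ₗ
      tensorForm (finiteDual R A).subtype (formOf (finiteDualAlg R H)) :=
  LinearMap.subtype_comp_codRestrict _ _ _

end DoiKoppinen

end DualStructure

/-! ### The axioms of the dual Doi-Koppinen structure -/

section DualStructure

variable {R : Type u} [CommRing R] [IsNoetherianRing R] {H : Type vH} {A : Type vA} {C : Type vC}
  [Ring H] [Bialgebra R H] [Ring A] [Algebra R A] [AddCommGroup C] [Module R C] [Coalgebra R C]

namespace DoiKoppinen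

variable (X : DoiKoppinen R H A C)

/-- On `C ⊗ H ⊗ H` this is the transpose of the associativity `(c h) k = c (h k)` of the action. -/
lemma transposeAct_coassoc (hH : IsAlphaAlgebra R H) (dH : FiniteDualBialgebra R H) :
    letI := dH.bialg
    TensorProduct.assoc R (ratDual X) (finiteDualAlg R H) (finiteDualAlg R H) ∘ₗ
        (X.transposeAct hH).rTensor (finiteDualAlg R H) ∘ₗ X.transposeAct hH =
      (Coalgebra.comul (R := R) (A := finiteDualAlg R H)).lTensor (ratDual X) ∘ₗ
        X.transposeAct hH := by
  let _ := dH.bialg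
  refine LinearMap.ext fun g => tensorForm_assoc_injective (formOf_injective (ratDual X))
    hH.separatesTensors_formOf hH.separatesTensors_formOf ?_
  have h1 : tensorForm (formOf (ratDual X)) (formOf (finiteDualAlg R H)) ∘ₗ X.transposeAct hH =
      X.act.toLinearMap.dualMap ∘ₗ formOf (ratDual X) :=
    LinearMap.ext (X.tensorForm_transposeAct hH)
  have h2 : tensorForm (formOf (finiteDualAlg R H)) (formOf (finiteDualAlg R H)) ∘ₗ
      dH.coalg.comul = (LinearMap.mul' R H).dualMap ∘ₗ formOf (finiteDualAlg R H) :=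
    LinearMap.ext dH.comul_apply
  rw [← LinearMap.cancel_right (TensorProduct.assoc R C H H).surjective]
  refine (tensorForm_assoc _ _ _ _).trans ?_
  refine (tensorForm_rTensor_of_comp_eq _ h1 _).trans ?_
  refine Eq.trans ?_ (congrArg (· ∘ₗ (TensorProduct.assoc R C H H).toLinearMap)
    (tensorForm_lTensor_of_comp_eq _ h2 _).symm)
  rw [tensorForm_transposeAct]
  refine TensorProduct.ext_threefold fun c h k => ?_
  simp only [LinearMap.comp_apply, LinearMap.rTensor_tmul, LinearEquiv.coe_coe,
    TensorProduct.assoc_tmul, LinearMap.lTensor_tmul, LinearMap.mul'_apply]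
  exact congrArg _ (X.act_mul c h k).symm

lemma transposeAct_counit (hH : IsAlphaAlgebra R H) (dH : FiniteDualBialgebra R H) :
    letI := dH.bialg
    TensorProduct.rid R (ratDual X) ∘ₗ
      (Coalgebra.counit (R := R) (A := finiteDualAlg R H)).lTensor (ratDual X) ∘ₗ
        X.transposeAct hH = LinearMap.id := by
  let _ := dH.bialg
  refine LinearMap.ext fun g => formOf_injective _ <| LinearMap.ext fun c => ?_
  refine (apply_rid_lTensor (formOf (ratDual X)) dH.counit_apply _ c).trans ?_
  rw [tensorForm_transposeAct]
  exact congrArg _ (X.act_one c)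

lemma transposeCoact_counit (dA : FiniteDualCoalgebra R A) (dH : FiniteDualBialgebra R H) :
    letI := dA.coalg
    letI := dH.bialg
    Coalgebra.counit (R := R) (A := finiteDual R A) ∘ₗ X.transposeCoact =
      Coalgebra.counit (R := R) (A := finiteDual R A ⊗[R] finiteDualAlg R H) := by
  let _ := dA.coalg
  let _ := dH.bialg
  refine TensorProduct.ext' fun f x => ?_
  refine (dA.counit_apply _).trans ?_
  change tensorForm _ _ (f ⊗ₜ x) (X.coact 1) = _
  rw [map_one, Algebra.TensorProduct.one_def, tensorForm_tmul, TensorProduct.counit_tmul,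
    smul_eq_mul, mul_comm]
  exact congrArg₂ _ (dH.counit_apply x).symm (dA.counit_apply f).symm

/-- On `A ⊗ A` this is the transpose of the multiplicativity of the coaction `A → A ⊗ H`. -/
lemma transposeCoact_comul (hA : IsAlphaAlgebra R A) (dA : FiniteDualCoalgebra R A)
    (dH : FiniteDualBialgebra R H) :
    letI := dA.coalg
    letI := dH.bialg
    TensorProduct.map X.transposeCoact X.transposeCoact ∘ₗ
        Coalgebra.comul (R := R) (A := finiteDual R A ⊗[R] finiteDualAlg R H) =
      Coalgebra.comul (R := R) (A := finiteDual R A) ∘ₗ X.transposeCoact := by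
  let _ := dA.coalg
  let _ := dH.bialg
  refine TensorProduct.ext' fun f x => tensorForm_injective (finiteDual R A).injective_subtype
    hA.separatesTensors ?_
  have h1 : tensorForm (finiteDual R A).subtype (finiteDual R A).subtype ∘ₗ dA.coalg.comul =
      (LinearMap.mul' R A).dualMap ∘ₗ (finiteDual R A).subtype := LinearMap.ext dA.comul_apply
  have h2 : tensorForm (formOf (finiteDualAlg R H)) (formOf (finiteDualAlg R H)) ∘ₗ
      dH.coalg.comul = (LinearMap.mul' R H).dualMap ∘ₗ formOf (finiteDualAlg R H) :=
    LinearMap.ext dH.comul_apply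
  have hco := X.subtype_comp_transposeCoact
  refine Eq.trans ?_ (dA.comul_apply _).symm
  refine (tensorForm_map_of_comp_eq hco hco _).trans ?_
  have h3 := tensorForm_tensorTensorTensorComm (finiteDual R A).subtype (finiteDual R A).subtype
    (formOf (finiteDualAlg R H)) (formOf (finiteDualAlg R H))
    (TensorProduct.map dA.coalg.comul dH.coalg.comul (f ⊗ₜ x))
  rw [tensorForm_map_of_comp_eq h1 h2] at h3
  have h4 : Coalgebra.comul (R := R) (f ⊗ₜ[R] x) = TensorProduct.tensorTensorTensorComm R _ _ _ _
      (TensorProduct.map dA.coalg.comul dH.coalg.comul (f ⊗ₜ x)) := rfl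
  rw [h4, h3]
  have h5 : (X.transposeCoact (f ⊗ₜ x)).1 = tensorForm (finiteDual R A).subtype
    (formOf (finiteDualAlg R H)) (f ⊗ₜ x) ∘ₗ X.coact.toLinearMap := rfl
  rw [h5]
  generalize tensorForm (finiteDual R A).subtype (formOf (finiteDualAlg R H)) (f ⊗ₜ x) = φ
  refine TensorProduct.ext' fun a b => ?_
  simp only [LinearMap.comp_apply, LinearEquiv.coe_coe, LinearMap.mul'_apply,
    TensorProduct.map_tmul, AlgHom.toLinearMap_apply, map_mul]
  congr 1
  generalize X.coact a = s
  generalize X.coact b = t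
  induction s with
  | zero => simp
  | add s s' hs hs' => simp only [TensorProduct.add_tmul, map_add, add_mul, hs, hs']
  | tmul a h =>
    induction t with
    | zero => simp
    | add t t' ht ht' => simp only [TensorProduct.tmul_add, map_add, mul_add, ht, ht']
    | tmul b k => simp

lemma transposeCoact_one (f : finiteDual R A) : X.transposeCoact (f ⊗ₜ 1) = f := by
  refine Subtype.ext (LinearMap.ext fun a => ?_)
  have h := LinearMap.congr_fun X.coact_counit a
  simp only [LinearMap.comp_apply, AlgHom.toLinearMap_apply, LinearMap.id_apply,
    LinearEquiv.coe_coe] at h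
  conv_rhs => rw [← h]
  change tensorForm _ _ (f ⊗ₜ 1) (X.coact a) = _
  generalize X.coact a = s
  induction s with
  | zero => simp
  | add s s' hs hs' => simp only [map_add, hs, hs']
  | tmul a h => simp [formOf_one_apply, mul_comm]

/-- The convolution product is transposed to the comultiplication of `H`, so this is the
coassociativity of the coaction on `A`. -/
lemma transposeCoact_mul (f : finiteDual R A) (x y : finiteDualAlg R H) :
    X.transposeCoact (f ⊗ₜ (x * y)) = X.transposeCoact (X.transposeCoact (f ⊗ₜ x) ⊗ₜ y) := by
  refine Subtype.ext (LinearMap.ext fun a => ?_)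
  have h := LinearMap.congr_fun X.coact_coassoc a
  simp only [LinearMap.comp_apply, AlgHom.toLinearMap_apply, LinearEquiv.coe_coe] at h
  have h1 := tensorForm_rTensor_of_comp_eq (formOf (finiteDualAlg R H))
    X.subtype_comp_transposeCoact ((f ⊗ₜ x) ⊗ₜ y)
  rw [← tensorForm_assoc, LinearMap.rTensor_tmul, TensorProduct.assoc_tmul] at h1
  change tensorForm _ _ (f ⊗ₜ (x * y)) (X.coact a) = tensorForm _ _ _ (X.coact a)
  rw [h1]
  simp only [LinearMap.comp_apply, LinearEquiv.coe_coe]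
  rw [h]
  generalize X.coact a = s
  induction s with
  | zero => simp
  | add s s' hs hs' => simp only [map_add, hs, hs']
  | tmul a h =>
    rw [tensorForm_tmul, formOf_mul_eq_tensorForm_comp_comul, LinearMap.lTensor_tmul,
      tensorForm_tmul]
    rfl

/-- The dual Doi-Koppinen structure `(H°, C⁰, A°)`. -/
noncomputable def dual (hH : IsAlphaAlgebra R H) (hA : IsAlphaAlgebra R A) : DualDK X where
  dualA := hA.finiteDualCoalgebra
  dualH := hH.finiteDualBialgebra
  dk :=
    letI := hA.finiteDualCoalgebra.coalg
    letI := hH.finiteDualBialgebra.bialg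
    { coact := X.transposeActAlgHom hH
      coact_coassoc := X.transposeAct_coassoc hH hH.finiteDualBialgebra
      coact_counit := X.transposeAct_counit hH hH.finiteDualBialgebra
      act := ⟨X.transposeCoact, X.transposeCoact_counit _ _, X.transposeCoact_comul hA _ _⟩
      act_one := X.transposeCoact_one
      act_mul := X.transposeCoact_mul }
  coact_apply := X.tensorForm_transposeAct hH
  act_apply _ _ := rfl

end DoiKoppinen

/-- The entwining map of the dual structure is the restriction of the transpose of `ψ`. -/
lemma DualDK.tensorForm_psi {X : DoiKoppinen R H A C} (S : DualDK X) :
    letI := S.dualA.coalg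
    letI := S.dualH.bialg
    ∀ (f : finiteDual R A) (g : ratDual X),
      tensorForm (formOf (ratDual X)) (finiteDual R A).subtype (S.dk.psi (f ⊗ₜ g)) =
        tensorForm (finiteDual R A).subtype (formOf (ratDual X)) (f ⊗ₜ g) ∘ₗ X.psi := by
  let _ := S.dualA.coalg
  let _ := S.dualH.bialg
  intro f g
  have h1 : (finiteDual R A).subtype ∘ₗ S.dk.act.toLinearMap = X.coact.toLinearMap.dualMap ∘ₗ
      tensorForm (finiteDual R A).subtype (formOf (finiteDualAlg R H)) :=
    TensorProduct.ext' S.act_apply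
  have h2 : tensorForm (formOf (ratDual X)) (formOf (finiteDualAlg R H)) ∘ₗ
      S.dk.coact.toLinearMap = X.act.toLinearMap.dualMap ∘ₗ formOf (ratDual X) :=
    LinearMap.ext S.coact_apply
  -- The three factors of the dual entwining map are transposed one at a time. Action and coaction
  -- change roles, the order is reversed, and the composite is `ψ` by definition.
  refine (tensorForm_lTensor_of_comp_eq _ h1 _).trans ?_
  refine (congrArg (· ∘ₗ _) (tensorForm_leftComm _ _ _ _)).trans ?_
  refine (congrArg (fun q => (q ∘ₗ _) ∘ₗ _) (tensorForm_lTensor_of_comp_eq _ h2 _)).trans ?_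
  rfl

end DualStructure

/-! ### Doi-Koppinen modules and rational modules -/

section Category

/-- Isomorphism here means equality of functors, so objects must correspond bijectively; the inverse
on morphisms is a preimage conjugated by `eqToHom`. -/
lemma isIsoOfCategories_of_bijective {𝒞 : Type*} {𝒟 : Type*} [Category 𝒞] [Category 𝒟]
    (F : 𝒞 ⥤ 𝒟) [F.Full] [F.Faithful] (hinj : Function.Injective F.obj)
    (hsurj : Function.Surjective F.obj) : IsIsoOfCategories F := by
  choose G hG using hsurj
  let G' : 𝒟 ⥤ 𝒞 :=
    { obj := G
      map := fun {Y Z} f => F.preimage (eqToHom (hG Y) ≫ f ≫ eqToHom (hG Z).symm)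
      map_id := fun Y => F.map_injective (by simp)
      map_comp := fun f g => F.map_injective (by simp) }
  refine ⟨G', CategoryTheory.Functor.ext (fun X => hinj (hG _)) fun X Y f => F.map_injective ?_,
    CategoryTheory.Functor.ext hG fun X Y f => ?_⟩
  · simp [G', eqToHom_map]
  · simp [G']

end Category

/-! ### Multiplication rules for the elements `c ↦ φ(c) a` of `#ᵒᵖ(C, A)` -/

namespace DoiKoppinen

variable {R : Type u} [CommRing R] {H : Type vH} {A : Type vA} {C : Type vC}
  [Ring H] [Bialgebra R H] [Ring A] [Algebra R A] [AddCommGroup C] [Module R C] [Coalgebra R C]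
  (X : DoiKoppinen R H A C)

/-- The element `c ↦ φ(c) a` of `#ᵒᵖ(C, A)`. -/
noncomputable def formSmul (φ : Module.Dual R C) (a : A) : X.SmashOp :=
  SmashOp.ofLin X (LinearMap.toSpanSingleton R A a ∘ₗ φ)

lemma toLin_formSmul (φ : Module.Dual R C) (a : A) (c : C) :
    (X.formSmul φ a).toLin c = φ c • a := rfl

lemma toLin_incl (a : A) (c : C) : (X.incl a).toLin c = Coalgebra.counit (R := R) c • a := rfl

lemma formSmul_counit (a : A) : X.formSmul Coalgebra.counit a = X.incl a := rfl

lemma mul'_lTensor_formSmul_one (φ : Module.Dual R C) (t : A ⊗[R] C) :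
    LinearMap.mul' R A ((X.formSmul φ 1).toLin.lTensor A t) = tensorSlice A φ t := by
  induction t with
  | zero => simp
  | add s t hs ht => simp only [map_add, hs, ht]
  | tmul a c => simp [toLin_formSmul]

/-- This product records the slices of `ψ`; it is the source of the compatibility of coaction and
`A`-action. -/
lemma toLin_incl_mul_formSmul_one (a : A) (φ : Module.Dual R C) (c : C) :
    (X.incl a * X.formSmul φ 1).toLin c = tensorSlice A φ (X.psi (c ⊗ₜ a)) := by
  rw [SmashOp.toLin_mul_apply, mul'_lTensor_formSmul_one]
  congr 2
  have h : ∀ d : C ⊗[R] C, (X.incl a).toLin.lTensor C d =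
      (TensorProduct.rid R C ((Coalgebra.counit (R := R) (A := C)).lTensor C d)) ⊗ₜ a := by
    intro d
    induction d with
    | zero => simp
    | add s t hs ht => simp only [map_add, hs, ht, TensorProduct.add_tmul]
    | tmul d e => simp [toLin_incl, TensorProduct.smul_tmul]
  rw [h, Coalgebra.lTensor_counit_comul]
  simp

/-- The factors appear in opposite order in the convolution: the left one is applied to `c₂`. With
`a = 1` this rule encodes coassociativity of the coaction. -/
lemma formSmul_one_mul_formSmul (φ : Module.Dual R C) (γ : Module.Dual R C) (a : A) :
    X.formSmul φ 1 * X.formSmul γ a = X.formSmul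
      (LinearMap.mul' R R ∘ₗ TensorProduct.map γ φ ∘ₗ Coalgebra.comul) a := by
  refine SmashOp.ext' X fun c => ?_
  rw [SmashOp.toLin_mul_apply, toLin_formSmul]
  simp only [LinearMap.comp_apply]
  generalize Coalgebra.comul (R := R) c = d
  induction d with
  | zero => simp
  | add s t hs ht => simp only [map_add, hs, ht, add_smul]
  | tmul d e =>
    simp [toLin_formSmul, psi_one, smul_smul, mul_comm]

lemma formSmul_one_mul_incl (φ : Module.Dual R C) (a : A) :
    X.formSmul φ 1 * X.incl a = X.formSmul φ a := by
  rw [← formSmul_counit, formSmul_one_mul_formSmul]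
  congr 1
  ext c
  have h : ∀ d : C ⊗[R] C, LinearMap.mul' R R (TensorProduct.map Coalgebra.counit φ d) =
      φ (TensorProduct.lid R C ((Coalgebra.counit (R := R) (A := C)).rTensor C d)) := by
    intro d
    induction d with
    | zero => simp
    | add s t hs ht => simp only [map_add, hs, ht]
    | tmul d e => simp
  simp only [LinearMap.comp_apply]
  rw [h, Coalgebra.rTensor_counit_comul]
  simp

lemma incl_mul (a b : A) : X.incl (a * b) = X.incl a * X.incl b := by
  refine SmashOp.ext' X fun c => ?_
  have h : ∀ s : A ⊗[R] C, LinearMap.mul' R A ((X.incl b).toLin.lTensor A s) =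
      TensorProduct.rid R A ((Coalgebra.counit (R := R) (A := C)).lTensor A s) * b := by
    intro s
    induction s with
    | zero => simp
    | add s t hs ht => simp only [map_add, hs, ht, add_mul]
    | tmul d e => simp [toLin_incl]
  have h' : ∀ d : C ⊗[R] C, (X.incl a).toLin.lTensor C d =
      (TensorProduct.rid R C ((Coalgebra.counit (R := R) (A := C)).lTensor C d)) ⊗ₜ a := by
    intro d
    induction d with
    | zero => simp
    | add s t hs ht => simp only [map_add, hs, ht, TensorProduct.add_tmul]
    | tmul d e => simp [toLin_incl, TensorProduct.smul_tmul]
  rw [SmashOp.toLin_mul_apply, h, h', Coalgebra.lTensor_counit_comul, TensorProduct.rid_tmul,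
    one_smul, psi_counit, toLin_incl, smul_mul_assoc]

/-- The ring map `A → #ᵒᵖ(C, A)`. -/
noncomputable def inclHom : A →+* X.SmashOp where
  toFun := X.incl
  map_one' := SmashOp.ext' X fun c => by
    rw [toLin_incl, SmashOp.toLin_one_apply, Algebra.algebraMap_eq_smul_one]
  map_mul' := X.incl_mul
  map_zero' := SmashOp.ext' X fun c => by rw [toLin_incl]; simp
  map_add' a b := SmashOp.ext' X fun c => by simp [toLin_incl]

/-- It makes the coaction of a rational module `R`-linear, since `R` acts there through `A`. -/
lemma incl_algebraMap_mul_formSmul_one (r : R) (φ : Module.Dual R C) :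
    X.incl (algebraMap R A r) * X.formSmul φ 1 =
      X.formSmul φ 1 * X.incl (algebraMap R A r) := by
  refine SmashOp.ext' X fun c => ?_
  rw [formSmul_one_mul_incl, toLin_incl_mul_formSmul_one, toLin_formSmul,
    Algebra.algebraMap_eq_smul_one, TensorProduct.tmul_smul, map_smul,
    psi_one, map_smul, tensorSlice_tmul, smul_comm]

end DoiKoppinen

/-! ### The functor to `#ᵒᵖ(C, A)`-modules is fully faithful and injective on objects -/

namespace DKMod

variable {R : Type u} [CommRing R] {H : Type vH} {A : Type vA} {C : Type vC}
  [Ring H] [Bialgebra R H] [Ring A] [Algebra R A] [AddCommGroup C] [Module R C] [Coalgebra R C]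
  {X : DoiKoppinen R H A C}

/-- The action of `c ↦ φ(c) 1` is the slice of the coaction at `φ`; if `C^*` separates tensors, the
action therefore determines the coaction. -/
lemma formSmul_one_smul (M : DKMod.{u, vH, vA, vC, w} X) (φ : Module.Dual R C) (m : M.carrier) :
    op (X.formSmul φ 1) • m = tensorSlice M.carrier φ (M.coact m) := by
  rw [smash_smul]
  generalize M.coact m = t
  induction t with
  | zero => simp
  | add s t hs ht => simp only [map_add, hs, ht]
  | tmul n c => simp [toLin_formSmul]

lemma incl_smul (M : DKMod.{u, vH, vA, vC, w} X) (a : A) (m : M.carrier) :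
    op (X.incl a) • m = op a • m := by
  have h := LinearMap.congr_fun M.coact_counit m
  simp only [LinearMap.comp_apply, LinearMap.id_apply, LinearEquiv.coe_coe] at h
  rw [smash_smul]
  conv_rhs => rw [← h]
  generalize M.coact m = t
  induction t with
  | zero => simp
  | add s t hs ht => simp only [map_add, hs, ht, smul_add]
  | tmul n c =>
    simp only [LinearMap.lTensor_tmul, toLin_incl, rsmul_tmul, TensorProduct.rid_tmul, op_smul,
      smul_assoc]
    exact ((Algebra.lsmul R R M.carrier (op a)).map_smul _ n).symm

instance : (toSmash.{u, vH, vA, vC, w} X).Faithful where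
  map_injective {M N f g} h := by
    refine Hom.ext (LinearMap.ext fun m => ?_)
    exact LinearMap.congr_fun (congrArg ModuleCat.Hom.hom h) m

/-- Linearity over the elements `c ↦ φ(c) 1` says that the map commutes with all slices of the
coactions, and separation turns this into colinearity. -/
lemma toSmash_full (hC : SeparatesTensors (Module.Dual.eval R C)) :
    (toSmash.{u, vH, vA, vC, w} X).Full where
  map_surjective {M N} g := by
    let g' : M.carrier →ₗ[X.SmashOpᵐᵒᵖ] N.carrier := g.hom
    let l : M.carrier →ₗ[Aᵐᵒᵖ] N.carrier :=
      { toFun := g'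
        map_add' := g'.map_add
        map_smul' := fun a m => by
          have h := g'.map_smul (op (X.incl a.unop)) m
          rwa [incl_smul, incl_smul] at h }
    refine ⟨⟨l, LinearMap.ext fun m => hC.ext fun φ => ?_⟩, rfl⟩
    simp only [LinearMap.comp_apply]
    rw [tensorSlice_rTensor]
    have h := g'.map_smul (op (X.formSmul φ 1)) m
    rw [formSmul_one_smul, formSmul_one_smul] at h
    exact h.symm

lemma toSmash_obj_injective (hC : SeparatesTensors (Module.Dual.eval R C)) :
    Function.Injective (toSmash.{u, vH, vA, vC, w} X).obj := by
  intro M M' h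
  -- These formulas are recorded before the modules are taken apart, so that they speak about the
  -- separate fields afterwards.
  have hI := M.incl_smul
  have hI' := M'.incl_smul
  have hF := M.formSmul_one_smul
  have hF' := M'.formSmul_one_smul
  obtain @⟨E, gE, rE, aE, tE, ρ, h1, h2, h3⟩ := M
  obtain @⟨E', gE', rE', aE', tE', ρ', h1', h2', h3'⟩ := M'
  injection h with e1 e2 e3
  subst e1
  obtain rfl := eq_of_heq e2
  have key := eq_of_heq e3
  have hs : ∀ (f : X.SmashOpᵐᵒᵖ) (m : E), _ = _ := fun f m => congrArg (fun I => I.smul f m) key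
  have ha : aE = aE' := by
    refine Module.ext' _ _ fun a m => ?_
    exact (hI a.unop m).symm.trans ((hs _ m).trans (hI' a.unop m))
  subst ha
  have hr : rE = rE' := by
    refine Module.ext' _ _ fun r m => ?_
    -- A scalar `r` acts as `r • 1` in `A`, so the `R`-structure is determined by the `A`-structure.
    have t1 := tE.smul_assoc r (1 : Aᵐᵒᵖ) m
    have t2 := tE'.smul_assoc r (1 : Aᵐᵒᵖ) m
    rw [one_smul] at t1 t2
    exact t1.symm.trans t2
  subst hr
  have hρ : ρ = ρ' := LinearMap.ext fun m => hC.ext fun φ =>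
    (hF φ m).symm.trans ((hs _ m).trans (hF' φ m))
  subst hρ
  rfl

end DKMod

/-! ### From rational modules to Doi-Koppinen modules -/

namespace DoiKoppinen

variable {R : Type u} [CommRing R] {H : Type vH} {A : Type vA} {C : Type vC}
  [Ring H] [Bialgebra R H] [Ring A] [Algebra R A] [AddCommGroup C] [Module R C] [Coalgebra R C]
  {X : DoiKoppinen R H A C}

lemma rsmul_lTensor_formSmul_one {N : Type w} [AddCommGroup N] [Module R N] [Module Aᵐᵒᵖ N]
    [IsScalarTower R Aᵐᵒᵖ N] (φ : Module.Dual R C) (t : N ⊗[R] C) :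
    rsmul R A N ((X.formSmul φ 1).toLin.lTensor N t) = tensorSlice N φ t := by
  induction t with
  | zero => simp
  | add s t hs ht => simp only [map_add, hs, ht]
  | tmul n c => simp [toLin_formSmul]

lemma rsmul_lTensor_incl_mul_formSmul_one {N : Type w} [AddCommGroup N] [Module R N]
    [Module Aᵐᵒᵖ N] [IsScalarTower R Aᵐᵒᵖ N] (a : A) (φ : Module.Dual R C) (t : N ⊗[R] C) :
    rsmul R A N ((X.incl a * X.formSmul φ 1).toLin.lTensor N t) =
      tensorSlice N φ (X.diagAct N (t ⊗ₜ a)) := by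
  induction t with
  | zero => simp
  | add s t hs ht => simp only [map_add, TensorProduct.add_tmul, hs, ht]
  | tmul n c =>
    simp only [LinearMap.lTensor_tmul, rsmul_tmul, toLin_incl_mul_formSmul_one, diagAct,
      LinearMap.comp_apply, LinearEquiv.coe_coe, TensorProduct.assoc_tmul]
    rw [tensorSlice_rTensor]
    generalize X.psi (c ⊗ₜ a) = s
    induction s with
    | zero => simp
    | add s t hs ht => simp only [map_add, TensorProduct.tmul_add, MulOpposite.op_add, add_smul, hs, ht]
    | tmul b d => simp

lemma tensorSlice_tensorSlice_assoc_symm {N D E : Type*} [AddCommGroup N] [Module R N]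
    [AddCommGroup D] [Module R D] [AddCommGroup E] [Module R E] (φ : Module.Dual R D)
    (γ : Module.Dual R E) (t : N ⊗[R] (D ⊗[R] E)) :
    tensorSlice N φ (tensorSlice (N ⊗[R] D) γ ((TensorProduct.assoc R N D E).symm t)) =
      tensorSlice N (LinearMap.mul' R R ∘ₗ TensorProduct.map φ γ) t := by
  induction t with
  | zero => simp
  | add s t hs ht => simp only [map_add, hs, ht]
  | tmul n c =>
    induction c with
    | zero => simp
    | add s t hs ht => simp only [map_add, TensorProduct.tmul_add, hs, ht]
    | tmul d e => simp [smul_smul, mul_comm]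

lemma tensorSlice_lTensor {N D E : Type*} [AddCommGroup N] [Module R N]
    [AddCommGroup D] [Module R D] [AddCommGroup E] [Module R E] (φ : Module.Dual R D)
    (q : E →ₗ[R] D) (t : N ⊗[R] E) :
    tensorSlice N φ (q.lTensor N t) = tensorSlice N (φ ∘ₗ q) t := by
  induction t with
  | zero => simp
  | add s t hs ht => simp only [map_add, hs, ht]
  | tmul n c => simp

section OfRational

variable {N : Type w} [AddCommGroup N] [Module R N] [Module Aᵐᵒᵖ N] [IsScalarTower R Aᵐᵒᵖ N]
  [Module X.SmashOpᵐᵒᵖ N]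

/-- The coaction of a rational `#ᵒᵖ(C, A)`-module. -/
noncomputable def rationalCoact (hC : SeparatesTensors (Module.Dual.eval R C))
    (hA : ∀ (a : A) (n : N), op (X.incl a) • n = op a • n)
    (hN : ∀ n : N, ∃ t : N ⊗[R] C, ∀ f : X.SmashOp, op f • n = rsmul R A N (f.toLin.lTensor N t)) :
    N →ₗ[R] N ⊗[R] C :=
  -- The slices of the chosen tensor are prescribed by the action, so by separation the choice is
  -- forced and is linear in `n`.
  have h : ∀ (φ : Module.Dual R C) (n : N),
      tensorSlice N φ (hN n).choose = op (X.formSmul φ 1) • n := fun φ n => by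
    rw [(hN n).choose_spec, rsmul_lTensor_formSmul_one]
  { toFun := fun n => (hN n).choose
    map_add' := fun m n => hC.ext fun φ => by
      change tensorSlice N φ _ = tensorSlice N φ _
      rw [map_add, h, h, h, smul_add]
    map_smul' := fun r n => hC.ext fun φ => by
      change tensorSlice N φ _ = tensorSlice N φ _
      have hr : ∀ n : N, r • n = op (X.incl (algebraMap R A r)) • n := fun n => by
        rw [hA, ← MulOpposite.algebraMap_apply, algebraMap_smul]
      rw [RingHom.id_apply, map_smul, h, h, hr, hr, smul_smul, smul_smul, ← op_mul, ← op_mul,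
        incl_algebraMap_mul_formSmul_one] }

variable (hC : SeparatesTensors (Module.Dual.eval R C))
  (hA : ∀ (a : A) (n : N), op (X.incl a) • n = op a • n)
  (hN : ∀ n : N, ∃ t : N ⊗[R] C, ∀ f : X.SmashOp, op f • n = rsmul R A N (f.toLin.lTensor N t))

lemma smul_eq_rationalCoact (f : X.SmashOp) (n : N) :
    op f • n = rsmul R A N (f.toLin.lTensor N (rationalCoact hC hA hN n)) :=
  (hN n).choose_spec f

lemma tensorSlice_rationalCoact (φ : Module.Dual R C) (n : N) :
    tensorSlice N φ (rationalCoact hC hA hN n) = op (X.formSmul φ 1) • n := by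
  rw [smul_eq_rationalCoact hC hA hN, rsmul_lTensor_formSmul_one]

/-- The Doi-Koppinen module given by a rational `#ᵒᵖ(C, A)`-module. -/
noncomputable def ofRational : DKMod.{u, vH, vA, vC, w} X where
  carrier := N
  coact := rationalCoact hC hA hN
  coact_coassoc := by
    refine LinearMap.ext fun n => (TensorProduct.assoc R N C C).symm.injective ?_
    simp only [LinearMap.comp_apply, LinearEquiv.coe_coe, LinearEquiv.symm_apply_apply]
    -- Tested on `φ` and `γ`, coassociativity reads `(n · φ) · γ = n · (φ γ)` for the corresponding
    -- elements of `#ᵒᵖ(C, A)`.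
    refine hC.ext fun φ => hC.ext fun γ => ?_
    change tensorSlice N γ (tensorSlice (N ⊗[R] C) φ _) =
      tensorSlice N γ (tensorSlice (N ⊗[R] C) φ _)
    rw [tensorSlice_rTensor, tensorSlice_rationalCoact, tensorSlice_rationalCoact,
      tensorSlice_tensorSlice_assoc_symm, tensorSlice_lTensor, tensorSlice_rationalCoact,
      smul_smul, ← op_mul, formSmul_one_mul_formSmul, LinearMap.comp_assoc]
  coact_counit := LinearMap.ext fun n => by
    refine (tensorSlice_rationalCoact hC hA hN Coalgebra.counit n).trans ?_
    rw [formSmul_counit, hA, op_one, one_smul]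
    rfl
  coact_smul n a := hC.ext fun φ => by
    change tensorSlice N φ _ = tensorSlice N φ _
    -- Compatibility is associativity of the action for the product of `X.incl a` with `c ↦ φ(c) 1`.
    rw [← rsmul_lTensor_incl_mul_formSmul_one, ← smul_eq_rationalCoact,
      tensorSlice_rationalCoact, ← hA, smul_smul, op_mul]

lemma toSmash_ofRational :
    (DKMod.toSmash X).obj (ofRational hC hA hN) = ModuleCat.of X.SmashOpᵐᵒᵖ N := by
  have : instModuleMulOppositeSmashOpCarrier (ofRational hC hA hN) =
      ‹Module X.SmashOpᵐᵒᵖ N› :=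
    Module.ext' _ _ fun f n => (smul_eq_rationalCoact hC hA hN f.unop n).symm
  exact congrArg (fun I : Module X.SmashOpᵐᵒᵖ N => @ModuleCat.of X.SmashOpᵐᵒᵖ _ N _ I) this

end OfRational

variable (X) in
/-- The right `A`-module structure of a right `#ᵒᵖ(C, A)`-module. -/
@[reducible] noncomputable def moduleOfSmash (N : Type w) [AddCommGroup N]
    [Module X.SmashOpᵐᵒᵖ N] : Module Aᵐᵒᵖ N :=
  Module.compHom N X.inclHom.op

variable (X) in
/-- The `R`-module structure of a right `#ᵒᵖ(C, A)`-module. -/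
@[reducible] noncomputable def moduleBaseOfSmash (N : Type w) [AddCommGroup N]
    [Module X.SmashOpᵐᵒᵖ N] : Module R N :=
  letI := X.moduleOfSmash N
  Module.compHom N (algebraMap R Aᵐᵒᵖ)

variable (X) in
lemma isScalarTower_moduleOfSmash (N : Type w) [AddCommGroup N] [Module X.SmashOpᵐᵒᵖ N] :
    letI := X.moduleOfSmash N
    letI := X.moduleBaseOfSmash N
    IsScalarTower R Aᵐᵒᵖ N := by
  let _ := X.moduleOfSmash N
  let _ := X.moduleBaseOfSmash N
  exact IsScalarTower.of_algebraMap_smul fun _ _ => rfl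

/-- The tensor form of rationality. -/
lemma exists_tensor_of_isRational {N : Type w} [AddCommGroup N] [Module R N] [Module Aᵐᵒᵖ N]
    [IsScalarTower R Aᵐᵒᵖ N] [Module X.SmashOpᵐᵒᵖ N]
    (hA : ∀ (a : A) (n : N), op (X.incl a) • n = op a • n) (n : N) :
    (∃ (k : ℕ) (m : Fin k → N) (c : Fin k → C), ∀ f : X.SmashOp,
      op f • n = ∑ i, op (X.incl (f.toLin (c i))) • m i) ↔
    ∃ t : N ⊗[R] C, ∀ f : X.SmashOp, op f • n = rsmul R A N (f.toLin.lTensor N t) := by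
  constructor
  · rintro ⟨k, m, c, h⟩
    exact ⟨∑ i, m i ⊗ₜ c i, fun f => by simp [h, hA]⟩
  · rintro ⟨t, h⟩
    obtain ⟨k, m, c, rfl⟩ := TensorProduct.exists_sum_tmul_eq t
    exact ⟨k, m, c, fun f => by simp [h, hA]⟩

end DoiKoppinen

/-! ### The isomorphisms of categories -/

namespace DKMod

variable {R : Type u} [CommRing R] {H : Type vH} {A : Type vA} {C : Type vC}
  [Ring H] [Bialgebra R H] [Ring A] [Algebra R A] [AddCommGroup C] [Module R C] [Coalgebra R C]
  {X : DoiKoppinen R H A C}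

lemma isRational_toSmash (M : DKMod.{u, vH, vA, vC, w} X) :
    IsRational X ((toSmash X).obj M) := fun m =>
  (exists_tensor_of_isRational M.incl_smul m).mpr ⟨M.coact m, fun f => M.smash_smul f m⟩

lemma exists_toSmash_obj_eq (hC : SeparatesTensors (Module.Dual.eval R C))
    (N : ModuleCat.{w} X.SmashOpᵐᵒᵖ) (hN : IsRational X N) :
    ∃ M : DKMod.{u, vH, vA, vC, w} X, (toSmash X).obj M = N := by
  let _ := X.moduleOfSmash N
  let _ := X.moduleBaseOfSmash N
  have := X.isScalarTower_moduleOfSmash N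
  exact ⟨ofRational hC (fun _ _ => rfl)
    fun n => (exists_tensor_of_isRational (fun _ _ => rfl) n).mp (hN n),
    toSmash_ofRational _ _ _⟩

/-- Doi-Koppinen modules are the same as rational `#ᵒᵖ(C, A)`-modules. -/
lemma isIsoOfCategories_lift_toSmash (hC : SeparatesTensors (Module.Dual.eval R C)) :
    IsIsoOfCategories ((IsRational X).lift (toSmash.{u, vH, vA, vC, w} X) isRational_toSmash) := by
  have := toSmash_full.{u, vH, vA, vC, w} (X := X) hC
  refine isIsoOfCategories_of_bijective _ (fun M N h => toSmash_obj_injective hC ?_) fun N => ?_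
  · exact congrArg ObjectProperty.FullSubcategory.obj h
  · obtain ⟨M, hM⟩ := exists_toSmash_obj_eq hC N.obj N.property
    exact ⟨M, ObjectProperty.FullSubcategory.ext hM⟩

lemma isIsoOfCategories_toSmash (hC : SeparatesTensors (Module.Dual.eval R C))
    (h : ∀ N : ModuleCat.{w} X.SmashOpᵐᵒᵖ, IsRational X N) :
    IsIsoOfCategories (toSmash.{u, vH, vA, vC, w} X) := by
  have := toSmash_full.{u, vH, vA, vC, w} (X := X) hC
  exact isIsoOfCategories_of_bijective _ (toSmash_obj_injective hC)
    fun N => exists_toSmash_obj_eq hC N (h N)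

end DKMod

/-! ### Subgeneration by `A ⊗ C`, and the finitely generated projective case -/

namespace DoiKoppinen

variable {R : Type u} [CommRing R] {H : Type vH} {A : Type vA} {C : Type vC}
  [Ring H] [Bialgebra R H] [Ring A] [Algebra R A] [AddCommGroup C] [Module R C] [Coalgebra R C]
  {X : DoiKoppinen R H A C}

section Subgenerated

/-- Rationality passes to direct sums and quotients by mapping the representing tensors. Submodules
need separation, to bring the tensor from `L ⊗ C` back to `N ⊗ C`. -/
lemma isRational_of_isSubgenerated (hC : SeparatesTensors (Module.Dual.eval R C))
    {N : ModuleCat.{w} X.SmashOpᵐᵒᵖ} (hN : IsSubgenerated X.SmashOpᵐᵒᵖ X.free.carrier N) :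
    IsRational X N := by
  obtain ⟨L, Λ, p, j, hp, hj⟩ := hN
  let _ := X.moduleOfSmash L
  let _ := X.moduleBaseOfSmash L
  have := X.isScalarTower_moduleOfSmash L
  let _ := X.moduleOfSmash N
  let _ := X.moduleBaseOfSmash N
  have := X.isScalarTower_moduleOfSmash N
  have hL : ∀ l : L, ∃ t : L ⊗[R] C, ∀ f : X.SmashOp,
      op f • l = rsmul R A L (f.toLin.lTensor L t) := by
    intro l
    obtain ⟨z, rfl⟩ := hp l
    induction z using Finsupp.induction_linear with
    | zero => exact ⟨0, by simp⟩
    | add y z hy hz =>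
      obtain ⟨s, hs⟩ := hy
      obtain ⟨t, ht⟩ := hz
      exact ⟨s + t, fun f => by rw [map_add, smul_add, hs, ht, map_add, map_add]⟩
    | single i x =>
      refine (exists_tensor_of_isRational (fun _ _ => rfl) _).mp ?_
      obtain ⟨k, m, c, h⟩ : ∃ (k : ℕ) (m : Fin k → X.free.carrier) (c : Fin k → C),
          ∀ f : X.SmashOp, op f • x = ∑ i, op (X.incl (f.toLin (c i))) • m i :=
        X.free.isRational_toSmash x
      refine ⟨k, fun a => p (Finsupp.single i (m a)), c, fun f => ?_⟩
      have h' := congrArg (p ∘ₗ Finsupp.lsingle i) (h f)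
      rw [map_sum, map_smul] at h'
      refine h'.trans (Finset.sum_congr rfl fun a _ => map_smul (p ∘ₗ Finsupp.lsingle i) _ _)
  intro n
  refine (exists_tensor_of_isRational (fun _ _ => rfl) n).mpr ?_
  obtain ⟨t, ht⟩ := hL (j n)
  let jR : N →ₗ[R] L :=
    { toFun := j
      map_add' := j.map_add
      map_smul' := fun r n => j.map_smul (X.inclHom.op (algebraMap R Aᵐᵒᵖ r)) n }
  -- The slice at `φ` is `j(n) · φ = j(n · φ)`, which lies in the image of `j`.
  obtain ⟨t, rfl⟩ := hC.mem_range_rTensor jR (t := t) fun φ =>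
    ⟨op (X.formSmul φ 1) • n, (j.map_smul _ n).trans
      ((ht _).trans (rsmul_lTensor_formSmul_one φ t))⟩
  refine ⟨t, fun f => hj ?_⟩
  rw [map_smul, ht]
  clear ht
  induction t with
  | zero => simp
  | add s t hs ht => simp only [map_add, hs, ht]
  | tmul n c =>
    simp only [LinearMap.lTensor_tmul, LinearMap.rTensor_tmul, rsmul_tmul]
    exact (j.map_smul (X.inclHom.op (op (f.toLin c))) n).symm

/-- The action `(m ⊗ c) f = ∑ m f(c₂)₀ ⊗ c₁ f(c₂)₁` of `f ∈ #ᵒᵖ(C, A)` on `M ⊗ C`. -/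
noncomputable def tensorSmash (M : Type w) [AddCommGroup M] [Module R M] [Module Aᵐᵒᵖ M]
    [IsScalarTower R Aᵐᵒᵖ M] (f : X.SmashOp) : M ⊗[R] C →ₗ[R] M ⊗[R] C :=
  X.diagAct M ∘ₗ f.toLin.lTensor (M ⊗[R] C) ∘ₗ
    (TensorProduct.assoc R M C C).symm.toLinearMap ∘ₗ
      (Coalgebra.comul (R := R) (A := C)).lTensor M

/-- The map `A → M`, `a ↦ m a`. -/
noncomputable def orbitMap {M : Type w} [AddCommGroup M] [Module R M] [Module Aᵐᵒᵖ M]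
    [IsScalarTower R Aᵐᵒᵖ M] (m : M) : A →ₗ[R] M :=
  rsmul R A M ∘ₗ TensorProduct.mk R M A m

/-- The images of `A ⊗ C` under the orbit maps generate `M ⊗ C`; this equivariance therefore carries
the module axioms over from `A ⊗ C`. -/
lemma tensorSmash_orbitMap {M : Type w} [AddCommGroup M] [Module R M] [Module Aᵐᵒᵖ M]
    [IsScalarTower R Aᵐᵒᵖ M] (f : X.SmashOp) (m : M) (t : A ⊗[R] C) :
    X.tensorSmash M f ((orbitMap m).rTensor C t) = (orbitMap m).rTensor C (X.freeSmash f t) := by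
  induction t with
  | zero => simp
  | add s t hs ht => simp only [map_add, hs, ht]
  | tmul b c =>
    simp only [tensorSmash, freeSmash, LinearMap.comp_apply, LinearMap.rTensor_tmul,
      LinearMap.lTensor_tmul, LinearEquiv.coe_coe, freeCoact_tmul]
    generalize Coalgebra.comul (R := R) c = d
    induction d with
    | zero => simp
    | add s t hs ht => simp only [map_add, TensorProduct.tmul_add, hs, ht]
    | tmul x y =>
      simp only [TensorProduct.assoc_symm_tmul, LinearMap.lTensor_tmul, freeAct_tmul, diagAct,
        LinearMap.comp_apply, LinearEquiv.coe_coe, TensorProduct.assoc_tmul]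
      generalize X.psi (x ⊗ₜ f.toLin y) = s
      induction s with
      | zero => simp
      | add s t hs ht => simp only [map_add, TensorProduct.tmul_add, hs, ht]
      | tmul a k => simp [orbitMap, mul_smul]

lemma _root_.DKMod.coact_smash_smul (M : DKMod.{u, vH, vA, vC, w} X) (f : X.SmashOp)
    (m : M.carrier) : M.coact (op f • m) = X.tensorSmash M.carrier f (M.coact m) := by
  have hco := LinearMap.congr_fun M.coact_coassoc m
  simp only [LinearMap.comp_apply, LinearEquiv.coe_coe] at hco
  rw [← LinearEquiv.eq_symm_apply] at hco
  simp only [tensorSmash, LinearMap.comp_apply, LinearEquiv.coe_coe]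
  rw [M.smash_smul, ← hco]
  generalize M.coact m = t
  induction t with
  | zero => simp
  | add t t' ht ht' => simp only [map_add, ht, ht']
  | tmul n c => simp [M.coact_smul]

/-- The coaction embeds `M` in `M ⊗ C`, the counit providing a left inverse, and the orbit maps
present `M ⊗ C` as a quotient of copies of `A ⊗ C` indexed by the elements of `M`. -/
lemma isSubgenerated_toSmash (M : DKMod.{u, vH, vA, vC, w} X) :
    IsSubgenerated X.SmashOpᵐᵒᵖ X.free.carrier ((DKMod.toSmash X).obj M) := by
  let Λ := ULift.{max w vA vC} M.carrier
  let π : (Λ →₀ X.free.carrier) →+ M.carrier ⊗[R] C :=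
    Finsupp.liftAddHom fun i => ((orbitMap i.down).rTensor C).toAddMonoidHom
  have hπs : ∀ (i : Λ) (t : X.free.carrier),
      π (Finsupp.single i t) = (orbitMap i.down).rTensor C t :=
    fun i t => Finsupp.liftAddHom_apply_single _ _ _
  have hπ : Function.Surjective π := by
    intro t
    induction t with
    | zero => exact ⟨0, map_zero π⟩
    | add s t hs ht =>
      obtain ⟨x, rfl⟩ := hs
      obtain ⟨y, rfl⟩ := ht
      exact ⟨x + y, map_add π x y⟩
    | tmul m c =>
      let o : X.free.carrier := (1 : A) ⊗ₜ[R] c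
      refine ⟨Finsupp.single ⟨m⟩ o, (hπs _ _).trans ?_⟩
      change (orbitMap m).rTensor C ((1 : A) ⊗ₜ[R] c) = _
      simp [orbitMap]
  let _ : SMul X.SmashOpᵐᵒᵖ (M.carrier ⊗[R] C) := ⟨fun f t => X.tensorSmash M.carrier f.unop t⟩
  have hsmul : ∀ (f : X.SmashOpᵐᵒᵖ) (z : Λ →₀ X.free.carrier), π (f • z) = f • π z := by
    intro f z
    change _ = X.tensorSmash M.carrier f.unop (π z)
    induction z using Finsupp.induction_linear with
    | zero => simp
    | add y z hy hz => rw [smul_add, map_add, hy, hz, map_add, map_add]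
    | single i t =>
      rw [Finsupp.smul_single, hπs, hπs]
      refine Eq.trans ?_ (tensorSmash_orbitMap f.unop i.down t).symm
      exact congrArg _ (X.smashAct_free f.unop t)
  -- The axioms are transported along the surjection `π`.
  let _ : Module X.SmashOpᵐᵒᵖ (M.carrier ⊗[R] C) := hπ.module X.SmashOpᵐᵒᵖ π hsmul
  let e : ULift.{max w vA vC} (M.carrier ⊗[R] C) ≃ₗ[X.SmashOpᵐᵒᵖ] M.carrier ⊗[R] C :=
    ULift.moduleEquiv
  let πl : (Λ →₀ X.free.carrier) →ₗ[X.SmashOpᵐᵒᵖ] M.carrier ⊗[R] C :=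
    { π with map_smul' := hsmul }
  let j : M.carrier →ₗ[X.SmashOpᵐᵒᵖ] M.carrier ⊗[R] C :=
    { toFun := M.coact
      map_add' := M.coact.map_add
      map_smul' := fun f m => M.coact_smash_smul f.unop m }
  have hj : Function.Injective j := fun m n h => by
    have hm := LinearMap.congr_fun M.coact_counit m
    have hn := LinearMap.congr_fun M.coact_counit n
    simp only [LinearMap.comp_apply, LinearMap.id_apply] at hm hn
    rw [← hm, ← hn]
    exact congrArg (fun t => TensorProduct.rid R M.carrier
      ((Coalgebra.counit (R := R) (A := C)).lTensor M.carrier t)) h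
  exact ⟨ModuleCat.of _ (ULift.{max w vA vC} (M.carrier ⊗[R] C)), Λ,
    e.symm.toLinearMap ∘ₗ πl, e.symm.toLinearMap ∘ₗ j, e.symm.surjective.comp hπ,
    e.symm.injective.comp hj⟩

/-- The rational modules form `σ[A ⊗ C]`. -/
lemma isRational_eq_isSubgenerated (hC : SeparatesTensors (Module.Dual.eval R C)) :
    IsRational.{u, vH, vA, vC, w} X = IsSubgenerated X.SmashOpᵐᵒᵖ X.free.carrier := by
  refine funext fun N => propext ⟨fun hN => ?_, isRational_of_isSubgenerated hC⟩
  obtain ⟨M, rfl⟩ := DKMod.exists_toSmash_obj_eq hC N hN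
  exact isSubgenerated_toSmash M

end Subgenerated

/-- If `C` is finitely generated and projective, every `#ᵒᵖ(C, A)`-module is rational. -/
lemma isRational_of_finite_projective [Module.Finite R C] [Module.Projective R C]
    (N : ModuleCat.{w} X.SmashOpᵐᵒᵖ) : IsRational X N := by
  obtain ⟨k, π, hπ⟩ := Module.Finite.exists_fin' R C
  obtain ⟨s, hs⟩ := Module.projective_lifting_property π LinearMap.id hπ
  intro n
  refine ⟨k, fun i => op (X.formSmul (LinearMap.proj i ∘ₗ s) 1) • n,
    fun i => π (Pi.single i 1), fun f => ?_⟩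
  -- Dual basis expansion `c = ∑ sᵢ(c) π(eᵢ)`: every `f` is a sum of products of the fixed elements
  -- `c ↦ sᵢ(c) 1` with elements coming from `A`.
  have hf : f = ∑ i, X.formSmul (LinearMap.proj i ∘ₗ s) 1 *
      X.incl (f.toLin (π (Pi.single i 1))) := by
    refine SmashOp.ext' X fun c => ?_
    have hsum : ∀ g : Fin k → X.SmashOp, (∑ i, g i).toLin c = ∑ i, (g i).toLin c := fun g =>
      LinearMap.sum_apply _ _ _
    rw [hsum]
    simp only [formSmul_one_mul_incl, toLin_formSmul, ← map_smul, ← map_sum]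
    congr 1
    have hc : π (s c) = c := LinearMap.congr_fun hs c
    conv_lhs => rw [← hc, pi_eq_sum_univ' (s c)]
    rfl
  conv_lhs => rw [hf, Finset.op_sum, Finset.sum_smul]
  simp only [op_mul, mul_smul]

end DoiKoppinen

/-! ### Functoriality of the dual structure -/

section Functoriality

variable {R : Type u} [CommRing R]

/-- On forms, the identity is the transpose of the multiplicativity of `φ`. -/
lemma map_comp_comul_of_transpose {U U' : Type*} [AddCommMonoid U] [Module R U] [AddCommMonoid U']
    [Module R U'] {A : Type vA} {B : Type vB} [Ring A] [Algebra R A] [Ring B] [Algebra R B]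
    {i : U →ₗ[R] Module.Dual R A} {j : U' →ₗ[R] Module.Dual R B} (hi : Function.Injective i)
    (hs : SeparatesTensors i) (φ : A →ₐ[R] B) {p : U' →ₗ[R] U}
    (hp : i ∘ₗ p = φ.toLinearMap.dualMap ∘ₗ j) {Δ : U →ₗ[R] U ⊗[R] U} {Δ' : U' →ₗ[R] U' ⊗[R] U'}
    (hΔ : ∀ x, tensorForm i i (Δ x) = i x ∘ₗ LinearMap.mul' R A)
    (hΔ' : ∀ x, tensorForm j j (Δ' x) = j x ∘ₗ LinearMap.mul' R B) :
    TensorProduct.map p p ∘ₗ Δ' = Δ ∘ₗ p := by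
  refine LinearMap.ext fun x => tensorForm_injective hi hs ?_
  have hx : i (p x) = j x ∘ₗ φ.toLinearMap := LinearMap.congr_fun hp x
  simp only [LinearMap.comp_apply]
  rw [tensorForm_map_of_comp_eq hp hp, hΔ, hΔ', hx]
  refine TensorProduct.ext' fun a b => ?_
  simp

/-- The restriction of the transpose of a coalgebra morphism to subalgebras of the convolution
algebras. -/
noncomputable def transposeCoalgHom {C : Type vC} {D : Type vD} [AddCommGroup C] [Module R C]
    [Coalgebra R C] [AddCommGroup D] [Module R D] [Coalgebra R D]
    (S : Subalgebra R (WithConv (C →ₗ[R] R))) (T : Subalgebra R (WithConv (D →ₗ[R] R)))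
    (δ : C →ₗc[R] D)
    (h : ∀ g : T, WithConv.toConv (formOf T g ∘ₗ δ.toLinearMap) ∈ S) : T →ₐ[R] S :=
  AlgHom.ofLinearMap
    { toFun := fun g => ⟨WithConv.toConv (formOf T g ∘ₗ δ.toLinearMap), h g⟩
      map_add' := fun _ _ => rfl
      map_smul' := fun _ _ => rfl }
    (formOf_injective S δ.counit_comp)
    fun f g => formOf_injective S (LinearMap.convMul_comp_coalgHom_distrib f.1 g.1 δ)

variable [IsNoetherianRing R]

/-- The translate of `f ∘ φ` by `a, b` is the pullback of the translate of `f` by `φ a, φ b`. -/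
lemma comp_algHom_mem_finiteDual {A : Type vA} {B : Type vB} [Ring A] [Algebra R A] [Ring B]
    [Algebra R B] (φ : A →ₐ[R] B) {f : Module.Dual R B} (hf : f ∈ finiteDual R B) :
    f ∘ₗ φ.toLinearMap ∈ finiteDual R A := by
  refine Submodule.FG.of_le (T := (bimoduleSpan f).map φ.toLinearMap.dualMap)
    (Submodule.FG.map _ hf) ?_
  refine Submodule.span_le.mpr ?_
  rintro _ ⟨⟨a, b⟩, rfl⟩
  refine ⟨_, mem_bimoduleSpan f (φ a) (φ b), ?_⟩
  ext x
  simp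

lemma finiteDual_eq_top (A : Type vA) [Ring A] [Algebra R A] [Module.Finite R A] :
    finiteDual R A = ⊤ :=
  eq_top_iff.mpr fun f _ => IsNoetherian.noetherian (bimoduleSpan f)

variable {H : Type vH} {A : Type vA} {C : Type vC}
  [Ring H] [Bialgebra R H] [Ring A] [Algebra R A] [AddCommGroup C] [Module R C] [Coalgebra R C]
  {K : Type vK} {B : Type vB} {D : Type vD}
  [Ring K] [Bialgebra R K] [Ring B] [Algebra R B] [AddCommGroup D] [Module R D] [Coalgebra R D]

/-- The algebra map `β° : K° → H°`. -/
noncomputable def finiteDualAlgMap (β : H →ₐc[R] K) : finiteDualAlg R K →ₐ[R] finiteDualAlg R H :=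
  transposeCoalgHom (finiteDualAlg R H) (finiteDualAlg R K) (β : H →ₗc[R] K) fun g =>
    comp_algHom_mem_finiteDual (β : H →ₐ[R] K) g.2

/-- The linear map `γ° : B° → A°`. -/
noncomputable def finiteDualMap (γ : A →ₐ[R] B) : finiteDual R B →ₗ[R] finiteDual R A :=
  (γ.toLinearMap.dualMap ∘ₗ (finiteDual R B).subtype).codRestrict (finiteDual R A)
    fun f => comp_algHom_mem_finiteDual γ f.2

/-! ### The dual of a morphism of Doi-Koppinen structures -/

namespace DoiKoppinen

variable {X : DoiKoppinen R H A C} {Y : DoiKoppinen R K B D}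

/-- If `g(d k) = ∑ gᵢ(d) uᵢ(k)`, then `g(δ(c h)) = g(δ(c) β(h)) = ∑ gᵢ(δ c) uᵢ(β h)`, and `uᵢ ∘ β`
lies in `H°`. -/
lemma Hom.comp_δ_mem_ratDual (F : Hom X Y)
    (hF : ∀ (c : C) (h : H), F.δ (X.act (c ⊗ₜ h)) = Y.act (F.δ c ⊗ₜ F.β h)) (g : ratDual Y) :
    WithConv.toConv (formOf (ratDual Y) g ∘ₗ F.δ.toLinearMap) ∈ ratDual X := by
  obtain ⟨t, ht⟩ := g.2
  have h1 : LinearMap.id ∘ₗ F.δ.toLinearMap.dualMap =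
      F.δ.toLinearMap.dualMap ∘ₗ LinearMap.id := rfl
  have h2 : formOf (finiteDualAlg R H) ∘ₗ (finiteDualAlgMap F.β).toLinearMap =
      F.β.toLinearMap.dualMap ∘ₗ formOf (finiteDualAlg R K) := rfl
  refine ⟨TensorProduct.map F.δ.toLinearMap.dualMap (finiteDualAlgMap F.β).toLinearMap t, ?_⟩
  rw [tensorForm_map_of_comp_eq h1 h2, ← ht]
  exact TensorProduct.ext' fun c h => congrArg g.1.ofConv (hF c h)

/-- The dual `(β°, δ⁰, γ°)` of a morphism `(β, γ, δ)` of Doi-Koppinen structures. -/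
lemma Hom.exists_dual (hH : IsAlphaAlgebra R H) (hA : IsAlphaAlgebra R A) (F : Hom X Y)
    (hF : ∀ g : ratDual Y,
      WithConv.toConv (formOf (ratDual Y) g ∘ₗ F.δ.toLinearMap) ∈ ratDual X)
    (S : DualDK X) (T : DualDK Y) :
    letI := S.dualA.coalg
    letI := S.dualH.bialg
    letI := T.dualA.coalg
    letI := T.dualH.bialg
    ∃ G : Hom T.dk S.dk,
      (∀ v : finiteDualAlg R K, formOf (finiteDualAlg R H) (G.β v) =
        formOf (finiteDualAlg R K) v ∘ₗ F.β.toLinearMap) ∧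
      (∀ g : ratDual Y, formOf (ratDual X) (G.γ g) = formOf (ratDual Y) g ∘ₗ F.δ.toLinearMap) ∧
      (∀ f : finiteDual R B, (G.δ f).1 = f.1 ∘ₗ F.γ.toLinearMap) := by
  let _ := S.dualA.coalg
  let _ := S.dualH.bialg
  let _ := T.dualA.coalg
  let _ := T.dualH.bialg
  have hβ : formOf (finiteDualAlg R H) ∘ₗ (finiteDualAlgMap F.β).toLinearMap =
      (F.β : H →ₐ[R] K).toLinearMap.dualMap ∘ₗ formOf (finiteDualAlg R K) := rfl
  have hγ : (finiteDual R A).subtype ∘ₗ finiteDualMap F.γ =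
      F.γ.toLinearMap.dualMap ∘ₗ (finiteDual R B).subtype := rfl
  let δ' := transposeCoalgHom (ratDual X) (ratDual Y) F.δ hF
  have hδ : formOf (ratDual X) ∘ₗ δ'.toLinearMap =
      F.δ.toLinearMap.dualMap ∘ₗ formOf (ratDual Y) := rfl
  let β' : finiteDualAlg R K →ₐc[R] finiteDualAlg R H :=
    { finiteDualAlgMap F.β, (finiteDualAlgMap F.β).toLinearMap with
      counit_comp := LinearMap.ext fun v => (S.dualH.counit_apply _).trans
        ((congrArg (formOf (finiteDualAlg R K) v) (map_one F.β)).trans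
          (T.dualH.counit_apply v).symm)
      map_comp_comul := map_comp_comul_of_transpose (formOf_injective (finiteDualAlg R H))
        hH.separatesTensors_formOf (F.β : H →ₐ[R] K) hβ S.dualH.comul_apply
        T.dualH.comul_apply }
  let γ' : finiteDual R B →ₗc[R] finiteDual R A :=
    { finiteDualMap F.γ with
      counit_comp := LinearMap.ext fun f => (S.dualA.counit_apply _).trans
        ((congrArg f.1 (map_one F.γ)).trans (T.dualA.counit_apply f).symm)
      map_comp_comul := map_comp_comul_of_transpose (finiteDual R A).injective_subtype
        hA.separatesTensors F.γ hγ S.dualA.comul_apply T.dualA.comul_apply }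
  refine ⟨⟨β', δ', γ', fun g f => ?_⟩, fun _ => rfl, fun _ => rfl, fun _ => rfl⟩
  -- As forms on `C ⊗ A`, both sides are computed from the transposes of `ψ`, and their equality is
  -- the entwining condition on the given morphism.
  refine tensorForm_injective (formOf_injective (ratDual X)) hA.separatesTensors ?_
  refine (tensorForm_map_of_comp_eq hδ hγ _).trans ?_
  refine Eq.trans ?_ (S.tensorForm_psi _ _).symm
  refine (congrArg (· ∘ₗ TensorProduct.map _ _) (T.tensorForm_psi f g)).trans ?_
  refine TensorProduct.ext' fun c a => ?_
  have h1 := tensorForm_map_of_comp_eq hγ hδ (f ⊗ₜ g)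
  have h2 : tensorForm (finiteDual R A).subtype (formOf (ratDual X)) (γ' f ⊗ₜ δ' g) =
      tensorForm (finiteDual R B).subtype (formOf (ratDual Y)) (f ⊗ₜ g) ∘ₗ
        TensorProduct.map F.γ.toLinearMap F.δ.toLinearMap := h1
  rw [h2]
  exact congrArg (tensorForm (finiteDual R B).subtype (formOf (ratDual Y)) (f ⊗ₜ g))
    (F.comm a c).symm

end DoiKoppinen

end Functoriality

theorem mainTheorem3 {R : Type u} [CommRing R] [IsNoetherianRing R]
    {H : Type vH} {A : Type vA} {C : Type vC} [Ring H] [Bialgebra R H] [Ring A] [Algebra R A]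
    [AddCommGroup C] [Module R C] [Coalgebra R C] (X : DoiKoppinen R H A C)
    (hH : IsAlphaAlgebra R H) (hA : IsAlphaAlgebra R A) :
    -- the dual structure `(H°, C⁰, A°)` exists
    Nonempty (DualDK X) ∧
    (∀ S : DualDK X,
      letI := S.dualA.coalg
      letI := S.dualH.bialg
      -- its entwining map is the restriction of the transpose of that of `(H, A, C)`
      (Function.Injective (tensorForm (formOf (ratDual X)) (finiteDual R A).subtype) ∧
        ∀ (f : finiteDual R A) (g : ratDual X),
          tensorForm (formOf (ratDual X)) (finiteDual R A).subtype (S.dk.psi (f ⊗ₜ g)) =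
            tensorForm (finiteDual R A).subtype (formOf (ratDual X)) (f ⊗ₜ g) ∘ₗ X.psi) ∧
      -- Doi-Koppinen modules are the same as rational modules
      (∃ hrat : ∀ M : DKMod.{u, max u vH, max u vC, max u vA, w} S.dk,
          IsRational S.dk ((DKMod.toSmash S.dk).obj M),
        IsIsoOfCategories ((IsRational S.dk).lift (DKMod.toSmash S.dk) hrat)) ∧
      -- the rational modules form `σ[C⁰ ⊗ A°]`
      (IsRational.{u, max u vH, max u vC, max u vA, w} S.dk =
        IsSubgenerated S.dk.SmashOpᵐᵒᵖ S.dk.free.carrier) ∧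
      -- the finitely generated projective case
      (Module.Finite R A → Module.Projective R A →
        finiteDual R A = ⊤ ∧
        IsIsoOfCategories
          (DKMod.toSmash S.dk :
            DKMod.{u, max u vH, max u vC, max u vA, w} S.dk ⥤ ModuleCat S.dk.SmashOpᵐᵒᵖ))) ∧
    -- morphisms
    (∀ {K : Type vK} {B : Type vB} {D : Type vD} [Ring K] [Bialgebra R K] [Ring B] [Algebra R B]
      [AddCommGroup D] [Module R D] [Coalgebra R D] (Y : DoiKoppinen R K B D),
      IsAlphaAlgebra R K → IsAlphaAlgebra R B → ∀ F : DoiKoppinen.Hom X Y,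
      ((∀ g : ratDual Y, WithConv.toConv (formOf (ratDual Y) g ∘ₗ F.δ.toLinearMap) ∈ ratDual X) →
        ∀ (S : DualDK X) (T : DualDK Y),
          letI := S.dualA.coalg
          letI := S.dualH.bialg
          letI := T.dualA.coalg
          letI := T.dualH.bialg
          ∃ G : DoiKoppinen.Hom T.dk S.dk,
            (∀ v : finiteDualAlg R K,
              formOf (finiteDualAlg R H) (G.β v) =
                formOf (finiteDualAlg R K) v ∘ₗ F.β.toLinearMap) ∧
            (∀ g : ratDual Y, formOf (ratDual X) (G.γ g) =
              formOf (ratDual Y) g ∘ₗ F.δ.toLinearMap) ∧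
            (∀ f : finiteDual R B, (G.δ f).1 = f.1 ∘ₗ F.γ.toLinearMap)) ∧
      -- two cases in which `δ^*(D⁰) ⊆ C⁰`
      ((∀ (c : C) (h : H), F.δ (X.act (c ⊗ₜ h)) = Y.act (F.δ c ⊗ₜ F.β h)) →
        ∀ g : ratDual Y,
          WithConv.toConv (formOf (ratDual Y) g ∘ₗ F.δ.toLinearMap) ∈ ratDual X) ∧
      (ratDual X = ⊤ → ∀ g : ratDual Y,
          WithConv.toConv (formOf (ratDual Y) g ∘ₗ F.δ.toLinearMap) ∈ ratDual X)) := by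
  refine ⟨⟨X.dual hH hA⟩, fun S => ?_, ?_⟩
  · let _ := S.dualA.coalg
    let _ := S.dualH.bialg
    -- Evaluations at elements of `A` already separate tensors with `A°`, hence so do all forms on
    -- the coalgebra `A°`.
    have hC : SeparatesTensors (Module.Dual.eval R (finiteDual R A)) :=
      hA.separatesTensors.dual_eval
    refine ⟨⟨tensorForm_injective (formOf_injective _) hA.separatesTensors, S.tensorForm_psi⟩,
      ⟨DKMod.isRational_toSmash, DKMod.isIsoOfCategories_lift_toSmash hC⟩,
      isRational_eq_isSubgenerated hC, fun _ _ => ?_⟩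
    have htop : finiteDual R A = ⊤ := finiteDual_eq_top A
    -- Here `A°` is all of `A^*`, the dual of a finitely generated projective module, so the dual
    -- basis argument applies to it.
    have : Module.Projective R (finiteDual R A) :=
      Module.Projective.of_equiv (LinearEquiv.ofTop _ htop).symm
    exact ⟨htop, DKMod.isIsoOfCategories_toSmash hC fun N => isRational_of_finite_projective N⟩
  · intro K B D _ _ _ _ _ _ _ Y _ _ F
    exact ⟨fun hF S T => F.exists_dual hH hA hF S T, fun hF g => F.comp_δ_mem_ratDual hF g,
      fun h g => h ▸ Algebra.mem_top⟩
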